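/- A function $\varphi:(0,\infty)\to(0,\infty)$ is called non-degenerate quasi-concave if $\varphi$ is non-decreasing, $\varphi(t)/t$ is non-increasing, and $$\lim_{t\to0+}\varphi(t)=\lim_{t\to\infty}\frac{\varphi(t)}{t}=\lim_{t\to0+}\frac{t}{\varphi(t)}=\lim_{t\to\infty}\frac1{\varphi(t)}=0 .$$ A positive sequence $(t_k)_{k\in\mathbb Z}$ is a discretizing sequence for $\varphi$ if, for all $k\in\mathbb Z$, $t_{k+1}\ge 2t_k$, $\varphi(t_{k+1})\ge 2\varphi(t_k)$ and $\frac{\varphi(t_{k+1})}{t_{k+1}}\le\frac12\,\frac{\varphi(t_k)}{t_k}$, and $\mathbb Z$ is a disjoint union $\mathbb Z_1\cup\mathbb Z_2$ with $\varphi(t_{k+1})\le2\varphi(t_k)$ for $k\in\mathbb Z_1$ and $\frac{\varphi(t_k)}{t_k}\le2\,\frac{\varphi(t_{k+1})}{t_{k+1}}$ for $k\in\mathbb Z_2$; every non-degenerate quasi-concave function has one. For a compatible couple $\overline X=(X_0,X_1)$ of Banach spaces let $K(t,x;\overline X)=\inf\{\|x_0\|_{X_0}+t\|x_1\|_{X_1}: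 x=x_0+x_1,\ x_i\in X_i\}$ be Peetre's K-functional, and for $1\le p\le\infty$ let $\overline X_{\varphi,p}=(X_0,X_1)_{\varphi,p}$ be the space of all $x\in X_0+X_1$ with $$\|x\|_{\varphi,p}=\Bigl(\sum_{k\in\mathbb Z}\Bigl(\frac{K(t_k,x;\overline X)}{\varphi(t_k)}\Bigr)^p\Bigr)^{1/p}<\infty$$ (the supremum over $k$ if $p=\infty$), where $(t_k)$ is a discretizing sequence for $\varphi$. **Theorem.** Let $\varphi_0,\varphi_1,\varphi$ be non-degenerate quasi-concave functions on $(0,\infty)$ and let $p\in[1,\infty]$. Put $\varphi(\varphi_0,\varphi_1)(t)=\varphi_0(t)\,\varphi\bigl(\varphi_1(t)/\varphi_0(t)\bigr)$. Then, for every compatible couple $\overline X$ of Banach spaces, $$(\overline X_{\varphi_0,p},\overline X_{\varphi_1,p})_{\varphi,p}=\overline X_{\varphi(\varphi_0,\varphi_1),p},$$ that is, the two sides are the same subspace of $X_0+X_1$ and their norms are equivalent. This holds whichever discretizing sequences for $\varphi_0$, $\varphi_1$, $\varphi$ and $\varphi(\varphi_0,\varphi_1)$ are used to form the four spaces, with constants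 of equivalence that do not depend on $\overline X$. -/

import Mathlib

open Set Filter Topology
open scoped ENNReal NNReal

namespace RealInterpolation

/-! ### Quasi-concave functions and discretizing sequences -/

/-- Positive non-degenerate quasi-concave functions on `(0, ∞)`. Only the values on `(0, ∞)`
are ever used. -/
structure IsNondegQuasiConcave (φ : ℝ → ℝ) : Prop where
  pos : ∀ t, 0 < t → 0 < φ t
  mono : MonotoneOn φ (Ioi 0)
  anti : AntitoneOn (fun t => φ t / t) (Ioi 0)
  tendsto_zero : Tendsto φ (𝓝[>] 0) (𝓝 0)
  tendsto_div_atTop : Tendsto (fun t => φ t / t) atTop (𝓝 0)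
  tendsto_div_zero : Tendsto (fun t => t / φ t) (𝓝[>] 0) (𝓝 0)
  tendsto_inv_atTop : Tendsto (fun t => 1 / φ t) atTop (𝓝 0)

/-- A sequence of positive numbers with `inf_k a (k+1) / a k ≥ 2`. -/
def StronglyIncreasing (a : ℤ → ℝ) : Prop :=
  (∀ k, 0 < a k) ∧ ∀ k, 2 ≤ a (k + 1) / a k

/-- A sequence of positive numbers with `sup_k a (k+1) / a k ≤ 1 / 2`. -/
def StronglyDecreasing (a : ℤ → ℝ) : Prop :=
  (∀ k, 0 < a k) ∧ ∀ k, a (k + 1) / a k ≤ 1 / 2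

/-- `t` is a discretizing sequence for `φ`. -/
structure IsDiscretizing (φ : ℝ → ℝ) (t : ℤ → ℝ) : Prop where
  strongIncr : StronglyIncreasing t
  strongIncr_comp : StronglyIncreasing (fun k => φ (t k))
  strongDecr_div : StronglyDecreasing (fun k => φ (t k) / t k)
  decomposition : ∃ Z₁ Z₂ : Set ℤ, Z₁ ∪ Z₂ = univ ∧ Z₁ ∩ Z₂ = ∅ ∧
    (∀ k ∈ Z₁, φ (t (k + 1)) ≤ 2 * φ (t k)) ∧
    (∀ k ∈ Z₂, φ (t k) / t k ≤ 2 * (φ (t (k + 1)) / t (k + 1)))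

/-- The function `φ(φ₀, φ₁)(t) = φ₀(t) φ(φ₁(t) / φ₀(t))`. -/
noncomputable def compose (φ φ₀ φ₁ : ℝ → ℝ) : ℝ → ℝ :=
  fun t => φ₀ t * φ (φ₁ t / φ₀ t)

/-! ### Banach couples and the real method

A normed space `X` contained in a vector space `A` is represented by its extended norm
`A → [0, ∞]`, which is the norm on `X` and `∞` outside `X`; so the space itself is the set of
points of finite norm. -/

/-- A compatible couple of Banach spaces: `X₀` and `X₁` are continuously and injectively
mapped into a common Hausdorff topological vector space `A`. -/
structure BanachCouple (𝕜 : Type*) [RCLike 𝕜] (X₀ X₁ A : Type*)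
    [NormedAddCommGroup X₀] [NormedSpace 𝕜 X₀] [CompleteSpace X₀]
    [NormedAddCommGroup X₁] [NormedSpace 𝕜 X₁] [CompleteSpace X₁]
    [AddCommGroup A] [Module 𝕜 A] [TopologicalSpace A] [IsTopologicalAddGroup A]
    [ContinuousSMul 𝕜 A] [T2Space A] where
  incl₀ : X₀ →L[𝕜] A
  incl₁ : X₁ →L[𝕜] A
  injective₀ : Function.Injective incl₀
  injective₁ : Function.Injective incl₁

/-- The extended norm on `A` of the normed space `X`, embedded by the injective map `j`:
it is `‖y‖` at `j y` and `∞` outside the range of `j`. -/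
noncomputable def imageNorm {X A : Type*} [NormedAddCommGroup X] (j : X → A) (x : A) : ℝ≥0∞ :=
  ⨅ (y : X) (_ : j y = x), ‖y‖ₑ

/-- The space on which an extended norm is finite. -/
def space {A : Type*} (N : A → ℝ≥0∞) : Set A := {x | N x < ∞}

/-- Peetre's K-functional of the couple of the spaces with extended norms `N₀`, `N₁`
(equal to `∞` outside the sum of the two spaces). -/
noncomputable def K {A : Type*} [AddCommGroup A] (N₀ N₁ : A → ℝ≥0∞) (t : ℝ) (x : A) : ℝ≥0∞ :=
  ⨅ (x₀ : A) (x₁ : A) (_ : x₀ + x₁ = x), N₀ x₀ + ENNReal.ofReal t * N₁ x₁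

/-- The (extended) norm of `ℓ_p(ℤ)`, `1 ≤ p ≤ ∞`, of a sequence with values in `[0, ∞]`. -/
noncomputable def lpNorm (p : ℝ≥0∞) (a : ℤ → ℝ≥0∞) : ℝ≥0∞ :=
  if p = ∞ then ⨆ k, a k else (∑' k, a k ^ p.toReal) ^ (1 / p.toReal)

/-- The extended norm of the real interpolation space `(X₀, X₁)_{φ,p}`, formed with the
sequence `t`: the `ℓ_p` norm of `K(t_k, x) / φ(t_k)`. -/
noncomputable def interpNorm {A : Type*} [AddCommGroup A] (φ : ℝ → ℝ) (t : ℤ → ℝ) (p : ℝ≥0∞)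
    (N₀ N₁ : A → ℝ≥0∞) (x : A) : ℝ≥0∞ :=
  lpNorm p (fun k => K N₀ N₁ (t k) x / ENNReal.ofReal (φ (t k)))

/-- The extended norm of `X_{φ,p}` for a Banach couple `X`. -/
noncomputable def BanachCouple.interp {𝕜 : Type*} [RCLike 𝕜] {X₀ X₁ A : Type*}
    [NormedAddCommGroup X₀] [NormedSpace 𝕜 X₀] [CompleteSpace X₀]
    [NormedAddCommGroup X₁] [NormedSpace 𝕜 X₁] [CompleteSpace X₁]
    [AddCommGroup A] [Module 𝕜 A] [TopologicalSpace A] [IsTopologicalAddGroup A]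
    [ContinuousSMul 𝕜 A] [T2Space A] (X : BanachCouple 𝕜 X₀ X₁ A)
    (φ : ℝ → ℝ) (t : ℤ → ℝ) (p : ℝ≥0∞) : A → ℝ≥0∞ :=
  interpNorm φ t p (imageNorm X.incl₀) (imageNorm X.incl₁)

/-! ### Discretizing sequences exist, and `φ(φ₀, φ₁)` is again non-degenerate -/

theorem IsNondegQuasiConcave.continuousOn {φ : ℝ → ℝ} (h : IsNondegQuasiConcave φ) :
    ContinuousOn φ (Ioi 0) := by
  intro a ha
  have ha' : (0 : ℝ) < a := ha
  apply ContinuousAt.continuousWithinAt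
  have hlow : Tendsto (fun s => φ a * min 1 (s / a)) (𝓝 a) (𝓝 (φ a)) := by
    have : ContinuousAt (fun s : ℝ => φ a * min 1 (s / a)) a := by fun_prop
    simpa [ContinuousAt, ha'.ne'] using this
  have hup : Tendsto (fun s => φ a * max 1 (s / a)) (𝓝 a) (𝓝 (φ a)) := by
    have : ContinuousAt (fun s : ℝ => φ a * max 1 (s / a)) a := by fun_prop
    simpa [ContinuousAt, ha'.ne'] using this
  have hpa := h.pos a ha'
  refine tendsto_of_tendsto_of_tendsto_of_le_of_le' hlow hup ?_ ?_
  · filter_upwards [lt_mem_nhds ha'] with s hs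
    rcases le_total s a with hsa | hsa
    · have := h.anti (show s ∈ Ioi 0 from hs) ha hsa
      simp only at this
      rw [div_le_div_iff₀ ha' hs] at this
      calc φ a * min 1 (s / a) ≤ φ a * (s / a) := by gcongr; exact min_le_right _ _
        _ ≤ φ s := by rw [← mul_div_assoc, div_le_iff₀ ha']; exact this
    · calc φ a * min 1 (s / a) ≤ φ a * 1 := by gcongr; exact min_le_left _ _
        _ ≤ φ s := by rw [mul_one]; exact h.mono ha hs hsa
  · filter_upwards [lt_mem_nhds ha'] with s hs
    rcases le_total s a with hsa | hsa
    · calc φ s ≤ φ a * 1 := by rw [mul_one]; exact h.mono hs ha hsa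
        _ ≤ _ := by gcongr; exact le_max_left _ _
    · have := h.anti ha (show s ∈ Ioi 0 from hs) hsa
      simp only at this
      rw [div_le_div_iff₀ hs ha'] at this
      calc φ s ≤ φ a * (s / a) := by rw [← mul_div_assoc, le_div_iff₀ ha']; exact this
        _ ≤ _ := by gcongr; exact le_max_right _ _

/-- The relation between two consecutive terms of the sequence constructed below. -/
def Step (φ : ℝ → ℝ) (a b : ℝ) : Prop :=
  2 * φ a ≤ φ b ∧ 2 * (a / φ a) ≤ b / φ b ∧ (φ b = 2 * φ a ∨ b / φ b = 2 * (a / φ a))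

theorem IsNondegQuasiConcave.tendsto_atTop {φ : ℝ → ℝ} (h : IsNondegQuasiConcave φ) :
    Tendsto φ atTop atTop := by
  have h1 : Tendsto (fun t => 1 / φ t) atTop (𝓝[>] 0) := by
    refine tendsto_nhdsWithin_iff.2 ⟨h.tendsto_inv_atTop, ?_⟩
    filter_upwards [eventually_gt_atTop 0] with t ht
    exact one_div_pos.2 (h.pos t ht)
  refine h1.inv_tendsto_nhdsGT_zero.congr fun t => ?_
  simp

theorem IsNondegQuasiConcave.tendsto_atTop' {φ : ℝ → ℝ} (h : IsNondegQuasiConcave φ) :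
    Tendsto (fun t => t / φ t) atTop atTop := by
  have h1 : Tendsto (fun t => φ t / t) atTop (𝓝[>] 0) := by
    refine tendsto_nhdsWithin_iff.2 ⟨h.tendsto_div_atTop, ?_⟩
    filter_upwards [eventually_gt_atTop 0] with t ht
    exact div_pos (h.pos t ht) ht
  have := h1.inv_tendsto_nhdsGT_zero
  refine this.congr fun t => ?_
  simp

theorem IsNondegQuasiConcave.exists_up {φ : ℝ → ℝ} (h : IsNondegQuasiConcave φ) {a : ℝ}
    (ha : 0 < a) : ∃ b, 0 < b ∧ Step φ a b := by
  have hpa := h.pos a ha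
  have hqa : 0 < a / φ a := div_pos ha hpa
  obtain ⟨c, hc1, hc2, hc3⟩ := ((h.tendsto_atTop.eventually_ge_atTop (2 * φ a)).and
    ((h.tendsto_atTop'.eventually_ge_atTop (2 * (a / φ a))).and (eventually_ge_atTop a))).exists
  have hsub : Icc a c ⊆ Ioi 0 := fun x hx => lt_of_lt_of_le ha hx.1
  have hcont : ContinuousOn (fun s => min (φ s / φ a) ((s / φ s) / (a / φ a))) (Icc a c) := by
    have h1 := h.continuousOn.mono hsub
    refine ContinuousOn.inf (h1.div_const _) (ContinuousOn.div_const ?_ _)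
    exact continuousOn_id.div h1 fun x hx => (h.pos x (hsub hx)).ne'
  have hmem : (2 : ℝ) ∈ Icc (min (φ a / φ a) ((a / φ a) / (a / φ a)))
      (min (φ c / φ a) ((c / φ c) / (a / φ a))) := by
    rw [div_self hpa.ne', div_self hqa.ne']
    exact ⟨by norm_num, le_min ((le_div_iff₀ hpa).2 hc1) ((le_div_iff₀ hqa).2 hc2)⟩
  obtain ⟨b, hb, hb2⟩ := intermediate_value_Icc hc3 hcont hmem
  simp only at hb2
  refine ⟨b, hsub hb, ?_, ?_, ?_⟩
  · rw [← le_div_iff₀ hpa, ← hb2]; exact min_le_left _ _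
  · rw [← le_div_iff₀ hqa, ← hb2]; exact min_le_right _ _
  · rcases min_choice (φ b / φ a) ((b / φ b) / (a / φ a)) with hm | hm
    · left; rw [hm] at hb2; exact (div_eq_iff hpa.ne').1 hb2
    · right; rw [hm] at hb2; exact (div_eq_iff hqa.ne').1 hb2

theorem IsNondegQuasiConcave.exists_down {φ : ℝ → ℝ} (h : IsNondegQuasiConcave φ) {b : ℝ}
    (hb : 0 < b) : ∃ a, 0 < a ∧ Step φ a b := by
  have hpb := h.pos b hb
  have hqb : 0 < b / φ b := div_pos hb hpb
  have e1 : ∀ᶠ s in 𝓝[>] (0 : ℝ), φ s ≤ φ b / 2 :=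
    (h.tendsto_zero.eventually_lt_const (half_pos hpb)).mono fun _ => le_of_lt
  have e2 : ∀ᶠ s in 𝓝[>] (0 : ℝ), s / φ s ≤ (b / φ b) / 2 :=
    (h.tendsto_div_zero.eventually_lt_const (half_pos hqb)).mono fun _ => le_of_lt
  have e3 : ∀ᶠ s in 𝓝[>] (0 : ℝ), s ∈ Ioo 0 b := Ioo_mem_nhdsGT hb
  obtain ⟨c, hc1, hc2, hc0, hc4'⟩ := (e1.and (e2.and e3)).exists
  have hc4 : c ≤ b := le_of_lt hc4'
  have hsub : Icc c b ⊆ Ioi 0 := fun x hx => lt_of_lt_of_le hc0 hx.1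
  have hcont : ContinuousOn (fun s => max (φ s / φ b) ((s / φ s) / (b / φ b))) (Icc c b) := by
    have h1 := h.continuousOn.mono hsub
    refine ContinuousOn.sup (h1.div_const _) (ContinuousOn.div_const ?_ _)
    exact continuousOn_id.div h1 fun x hx => (h.pos x (hsub hx)).ne'
  have hmem : (1 / 2 : ℝ) ∈ Icc (max (φ c / φ b) ((c / φ c) / (b / φ b)))
      (max (φ b / φ b) ((b / φ b) / (b / φ b))) := by
    rw [div_self hpb.ne', div_self hqb.ne']
    refine ⟨max_le ((div_le_iff₀ hpb).2 ?_) ((div_le_iff₀ hqb).2 ?_), by norm_num⟩ <;> linarith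
  obtain ⟨a, ha, ha2⟩ := intermediate_value_Icc hc4 hcont hmem
  simp only at ha2
  refine ⟨a, hsub ha, ?_, ?_, ?_⟩
  · have : φ a / φ b ≤ 1 / 2 := by rw [← ha2]; exact le_max_left _ _
    rw [div_le_iff₀ hpb] at this; linarith
  · have : (a / φ a) / (b / φ b) ≤ 1 / 2 := by rw [← ha2]; exact le_max_right _ _
    rw [div_le_iff₀ hqb] at this; linarith
  · rcases max_choice (φ a / φ b) ((a / φ a) / (b / φ b)) with hm | hm
    · left; rw [hm, div_eq_iff hpb.ne'] at ha2; linarith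
    · right; rw [hm, div_eq_iff hqb.ne'] at ha2; linarith

/-- Every non-degenerate quasi-concave function has a discretizing sequence. -/
theorem IsNondegQuasiConcave.exists_isDiscretizing {φ : ℝ → ℝ} (h : IsNondegQuasiConcave φ) :
    ∃ t, IsDiscretizing φ t := by
  have hu : ∀ a : {a : ℝ // 0 < a}, ∃ b : {b : ℝ // 0 < b}, Step φ a b := fun a => by
    obtain ⟨b, hb, hs⟩ := h.exists_up a.2
    exact ⟨⟨b, hb⟩, hs⟩
  have hd : ∀ b : {b : ℝ // 0 < b}, ∃ a : {a : ℝ // 0 < a}, Step φ a b := fun b => by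
    obtain ⟨a, ha, hs⟩ := h.exists_down b.2
    exact ⟨⟨a, ha⟩, hs⟩
  choose u hu using hu
  choose d hd using hd
  let e : {a : ℝ // 0 < a} := ⟨1, one_pos⟩
  let T : ℤ → {a : ℝ // 0 < a} := fun k => match k with
    | Int.ofNat n => u^[n] e
    | Int.negSucc n => d^[n + 1] e
  have hT : ∀ k, Step φ (T k) (T (k + 1)) := by
    intro k
    match k with
    | Int.ofNat n =>
      have : T (Int.ofNat n + 1) = u (u^[n] e) := by
        rw [← Function.iterate_succ_apply' u n e]; rfl
      rw [this]; exact hu _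
    | Int.negSucc 0 => exact hd _
    | Int.negSucc (n + 1) =>
      have h1 : T (Int.negSucc (n + 1)) = d (d^[n + 1] e) := by
        rw [← Function.iterate_succ_apply' d (n + 1) e]
      have h2 : T (Int.negSucc (n + 1) + 1) = d^[n + 1] e := rfl
      rw [h1, h2]; exact hd _
  have hp : ∀ k, 0 < φ (T k) := fun k => h.pos _ (T k).2
  have hq : ∀ k, 0 < (T k : ℝ) / φ (T k) := fun k => div_pos (T k).2 (hp k)
  have hinv : ∀ k, φ (T k) / (T k : ℝ) = ((T k : ℝ) / φ (T k))⁻¹ := fun k => by rw [inv_div]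
  refine ⟨fun k => T k, ⟨fun k => (T k).2, fun k => ?_⟩, ⟨hp, fun k => ?_⟩,
    ⟨fun k => div_pos (hp k) (T k).2, fun k => ?_⟩,
    {k | φ (T (k + 1)) ≤ 2 * φ (T k)}, {k | φ (T (k + 1)) ≤ 2 * φ (T k)}ᶜ,
    union_compl_self _, inter_compl_self _, fun k hk => hk, fun k hk => ?_⟩
  · obtain ⟨h1, h2, -⟩ := hT k
    have e1 : ∀ j, (T j : ℝ) = φ (T j) * (T j / φ (T j)) := fun j => by
      field_simp [(hp j).ne']
    rw [le_div_iff₀ (T k).2]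
    calc 2 * (T k : ℝ) ≤ 4 * (T k : ℝ) := by linarith [(T k).2]
      _ = (2 * φ (T k)) * (2 * ((T k : ℝ) / φ (T k))) := by rw [e1 k]; field_simp [(hp k).ne']; ring
      _ ≤ φ (T (k + 1)) * (T (k + 1) / φ (T (k + 1))) := by
        have := hq k; have := hp k; have := hp (k + 1); gcongr
      _ = _ := (e1 (k + 1)).symm
  · exact (le_div_iff₀ (hp k)).2 (hT k).1
  · have := (hT k).2.1
    simp only [hinv]
    rw [inv_div_inv, div_le_iff₀ (hq (k + 1))]; linarith
  · obtain ⟨h1, h2, h3⟩ := hT k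
    rcases h3 with h3 | h3
    · exact absurd h3.le hk
    · simp only [hinv, h3, mul_inv]
      linarith

theorem IsNondegQuasiConcave.perspective_mono {φ : ℝ → ℝ} (h : IsNondegQuasiConcave φ)
    {x x' y y' : ℝ} (hx : 0 < x) (hy : 0 < y) (hxx : x ≤ x') (hyy : y ≤ y') :
    x * φ (y / x) ≤ x' * φ (y' / x') := by
  have hx' : 0 < x' := hx.trans_le hxx
  have h1 : φ (y / x) / (y / x) ≤ φ (y / x') / (y / x') :=
    h.anti (show (0 : ℝ) < y / x' by positivity) (show (0 : ℝ) < y / x by positivity)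
      (by gcongr)
  have h2 : φ (y / x') ≤ φ (y' / x') :=
    h.mono (show (0 : ℝ) < y / x' by positivity)
      (show (0 : ℝ) < y' / x' from div_pos (hy.trans_le hyy) hx') (by gcongr)
  calc x * φ (y / x) = y * (φ (y / x) / (y / x)) := by field_simp
    _ ≤ y * (φ (y / x') / (y / x')) := by gcongr
    _ = x' * φ (y / x') := by field_simp
    _ ≤ _ := by gcongr

/-- `φ(φ₀, φ₁)` is a positive non-degenerate quasi-concave function. -/
theorem IsNondegQuasiConcave.compose {φ φ₀ φ₁ : ℝ → ℝ} (h : IsNondegQuasiConcave φ)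
    (h₀ : IsNondegQuasiConcave φ₀) (h₁ : IsNondegQuasiConcave φ₁) :
    IsNondegQuasiConcave (compose φ φ₀ φ₁) := by
  have hc : 0 < φ 1 := h.pos 1 one_pos
  have hup : ∀ {x y : ℝ}, 0 < x → 0 < y → x * φ (y / x) ≤ (x + y) * φ 1 := fun {x y} hx hy => by
    have := h.perspective_mono hx hy (show x ≤ x + y by linarith) (show y ≤ x + y by linarith)
    rwa [div_self (by positivity)] at this
  have hlo : ∀ {x y : ℝ}, 0 < x → 0 < y → 1 / (x * φ (y / x)) ≤ (1 / x + 1 / y) / φ 1 :=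
    fun {x y} hx hy => by
      have hm : 0 < min x y := lt_min hx hy
      have := h.perspective_mono hm hm (min_le_left x y) (min_le_right x y)
      rw [div_self hm.ne'] at this
      calc 1 / (x * φ (y / x)) ≤ 1 / (min x y * φ 1) := by gcongr
        _ = (1 / min x y) / φ 1 := by field_simp
        _ ≤ _ := by
          gcongr
          have := one_div_pos.2 hx
          have := one_div_pos.2 hy
          rcases min_choice x y with e | e <;> rw [e] <;> linarith
  have hpos : ∀ t, 0 < t → 0 < RealInterpolation.compose φ φ₀ φ₁ t := fun t ht =>
    mul_pos (h₀.pos t ht) (h.pos _ (div_pos (h₁.pos t ht) (h₀.pos t ht)))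
  have hdiv : ∀ t, 0 < t → RealInterpolation.compose φ φ₀ φ₁ t / t =
      φ₀ t / t * φ ((φ₁ t / t) / (φ₀ t / t)) := fun t ht => by
    rw [div_div_div_cancel_right₀ ht.ne', RealInterpolation.compose]; ring
  refine ⟨hpos, ?_, ?_, ?_, ?_, ?_, ?_⟩
  · intro s hs t ht hst
    exact h.perspective_mono (h₀.pos s hs) (h₁.pos s hs) (h₀.mono hs ht hst) (h₁.mono hs ht hst)
  · intro s hs t ht hst
    simp only
    rw [hdiv s hs, hdiv t ht]
    exact h.perspective_mono (div_pos (h₀.pos t ht) ht) (div_pos (h₁.pos t ht) ht)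
      (h₀.anti hs ht hst) (h₁.anti hs ht hst)
  · have hl := (h₀.tendsto_zero.add h₁.tendsto_zero).mul_const (φ 1)
    simp only [add_zero, zero_mul] at hl
    refine tendsto_of_tendsto_of_tendsto_of_le_of_le' tendsto_const_nhds hl ?_ ?_
    · filter_upwards [self_mem_nhdsWithin] with t ht using (hpos t ht).le
    · filter_upwards [self_mem_nhdsWithin] with t ht using hup (h₀.pos t ht) (h₁.pos t ht)
  · have hl := (h₀.tendsto_div_atTop.add h₁.tendsto_div_atTop).mul_const (φ 1)
    simp only [add_zero, zero_mul] at hl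
    refine tendsto_of_tendsto_of_tendsto_of_le_of_le' tendsto_const_nhds hl ?_ ?_
    · filter_upwards [eventually_gt_atTop 0] with t ht using (div_pos (hpos t ht) ht).le
    · filter_upwards [eventually_gt_atTop 0] with t ht
      rw [hdiv t ht]
      exact hup (div_pos (h₀.pos t ht) ht) (div_pos (h₁.pos t ht) ht)
  · have hl := (h₀.tendsto_div_zero.add h₁.tendsto_div_zero).div_const (φ 1)
    simp only [add_zero, zero_div] at hl
    refine tendsto_of_tendsto_of_tendsto_of_le_of_le' tendsto_const_nhds hl ?_ ?_
    · filter_upwards [self_mem_nhdsWithin] with t ht using (div_pos ht (hpos t ht)).le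
    · filter_upwards [self_mem_nhdsWithin] with t ht
      have := hlo (div_pos (h₀.pos t ht) ht) (div_pos (h₁.pos t ht) ht)
      rw [← hdiv t ht] at this
      simpa only [one_div_div] using this
  · have hl := (h₀.tendsto_inv_atTop.add h₁.tendsto_inv_atTop).div_const (φ 1)
    simp only [add_zero, zero_div] at hl
    refine tendsto_of_tendsto_of_tendsto_of_le_of_le' tendsto_const_nhds hl ?_ ?_
    · filter_upwards [eventually_gt_atTop 0] with t ht using (one_div_pos.2 (hpos t ht)).le
    · filter_upwards [eventually_gt_atTop 0] with t ht using hlo (h₀.pos t ht) (h₁.pos t ht)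

end RealInterpolation

namespace RealInterpolation

/-! ### The extended `ℓ_p` norm on an arbitrary index type -/

/-! Write ψ = φ(φ₀,φ₁), α_k = K(t'_k, x)/ψ(t'_k) and r_k = φ₁(t'_k)/φ₀(t'_k), so that ψ(t'_k) =
φ₀(t'_k) φ(r_k). Both embeddings compare r_k with the sequence t_m that discretizes φ.

From the iterated space into X_{ψ,p} (`interp_compose_le`): group the k with t_m ≤ r_k < t_{m+1}
into the m-th block. By the Z₁/Z₂ alternative, φ(r) or φ(r)/r varies there by a factor at most 2, so
for s = t_{m+1} or s = t_m both φ₀ and (1/s)φ₁ are at most 2ψ/φ(s) at the points t'_k of the block.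
Splitting x = x₀ + x₁ and estimating each part along the block bounds the ℓ_p norm of α over the
block by a multiple of K(s, x; X_{φ₀,p}, X_{φ₁,p})/φ(s). It remains to take the ℓ_p norm in m.

From X_{ψ,p} into the iterated space (`interpNorm_interp_le`): differences of nearly optimal
decompositions give x = Σ U_k with K(s, U_k) at most a constant times ψ(t'_k) min(1, s/t'_k)(α_{k-1}
+ α_k + α_{k+1}) (`exists_atoms`). The decomposition of x used at t_m puts the atoms with r_k < t_m
into X_{φ₀,p} and the others into X_{φ₁,p}.

All the ℓ_p bounds reduce to one Schur test (`lpE_schur`), whose row and column sums are geometric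
series controlled by `tsum_atoms_le` and its dual. The sequences are arbitrary throughout and the
constants are numerical, which gives the independence of the sequences and of the couple. -/

/-- The (extended) norm of `ℓ_p(ι)` of a family with values in `[0, ∞]`. -/
noncomputable def lpE {ι : Type*} (p : ℝ≥0∞) (a : ι → ℝ≥0∞) : ℝ≥0∞ :=
  if p = ∞ then ⨆ k, a k else (∑' k, a k ^ p.toReal) ^ (1 / p.toReal)

section lpE

variable {ι κ : Type*} {p : ℝ≥0∞}

theorem lpE_top (a : ι → ℝ≥0∞) : lpE ∞ a = ⨆ k, a k := if_pos rfl

theorem lpE_of_ne_top (hp : p ≠ ∞) (a : ι → ℝ≥0∞) :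
    lpE p a = (∑' k, a k ^ p.toReal) ^ (1 / p.toReal) := if_neg hp

theorem one_le_toReal (hp : 1 ≤ p) (hp' : p ≠ ∞) : 1 ≤ p.toReal := by
  simpa using ENNReal.toReal_mono hp' hp

theorem lpE_rpow (hp : 1 ≤ p) (hp' : p ≠ ∞) (a : ι → ℝ≥0∞) :
    lpE p a ^ p.toReal = ∑' k, a k ^ p.toReal := by
  have h1 := one_le_toReal hp hp'
  rw [lpE_of_ne_top hp', ← ENNReal.rpow_mul, one_div_mul_cancel (by linarith), ENNReal.rpow_one]

theorem lpE_le_iff (hp : 1 ≤ p) (hp' : p ≠ ∞) (a : ι → ℝ≥0∞) (B : ℝ≥0∞) :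
    lpE p a ≤ B ↔ ∑' k, a k ^ p.toReal ≤ B ^ p.toReal := by
  have h1 := one_le_toReal hp hp'
  rw [← lpE_rpow hp hp', ENNReal.rpow_le_rpow_iff (by linarith)]

theorem lpE_mono (hp : 1 ≤ p) {a b : ι → ℝ≥0∞} (h : ∀ k, a k ≤ b k) : lpE p a ≤ lpE p b := by
  by_cases hp' : p = ∞
  · subst hp'
    simpa only [lpE_top] using iSup_mono h
  · rw [lpE_le_iff hp hp', lpE_rpow hp hp']
    exact ENNReal.tsum_le_tsum fun k => ENNReal.rpow_le_rpow (h k) ENNReal.toReal_nonneg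

theorem le_lpE (hp : 1 ≤ p) (a : ι → ℝ≥0∞) (k : ι) : a k ≤ lpE p a := by
  by_cases hp' : p = ∞
  · subst hp'
    rw [lpE_top]
    exact le_iSup a k
  · have h1 := one_le_toReal hp hp'
    rw [← ENNReal.rpow_le_rpow_iff (show 0 < p.toReal by linarith), lpE_rpow hp hp']
    exact ENNReal.le_tsum (f := fun k => a k ^ p.toReal) k

theorem lpE_const_mul (hp : 1 ≤ p) (c : ℝ≥0∞) (a : ι → ℝ≥0∞) :
    lpE p (fun k => c * a k) = c * lpE p a := by
  by_cases hp' : p = ∞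
  · subst hp'
    simp only [lpE_top, ENNReal.mul_iSup]
  · have h1 := one_le_toReal hp hp'
    have h0 : p.toReal ≠ 0 := by linarith
    simp only [lpE_of_ne_top hp', ENNReal.mul_rpow_of_nonneg _ _ ENNReal.toReal_nonneg,
      ENNReal.tsum_mul_left]
    rw [ENNReal.mul_rpow_of_nonneg _ _ (by positivity), ← ENNReal.rpow_mul,
      mul_one_div_cancel h0, ENNReal.rpow_one]

/-- Iterated ℓ_p norms collapse to one norm over a product because the inner and outer exponents
agree. This is where the same p in all the spaces is essential. -/
theorem lpE_prod (hp : 1 ≤ p) (a : ι → κ → ℝ≥0∞) :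
    lpE p (fun q : ι × κ => a q.1 q.2) = lpE p (fun i => lpE p (a i)) := by
  by_cases hp' : p = ∞
  · subst hp'
    simp only [lpE_top, iSup_prod]
  · rw [lpE_of_ne_top hp', lpE_of_ne_top hp']
    simp only [lpE_rpow hp hp']
    rw [ENNReal.tsum_prod (f := fun i j => a i j ^ p.toReal)]

theorem lpE_comp_le (hp : 1 ≤ p) (a : ι → ℝ≥0∞) {e : κ → ι} (he : Function.Injective e) :
    lpE p (fun k => a (e k)) ≤ lpE p a := by
  by_cases hp' : p = ∞
  · subst hp'
    simp only [lpE_top]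
    exact iSup_le fun k => le_iSup a (e k)
  · rw [lpE_le_iff hp hp', lpE_rpow hp hp']
    exact ENNReal.tsum_comp_le_tsum_of_injective he (fun i => a i ^ p.toReal)

/-- Jensen's inequality for countable sums with weights. -/
theorem tsum_mul_rpow_le {q : ℝ} (hq : 1 ≤ q) (c a : κ → ℝ≥0∞) :
    (∑' j, c j * a j) ^ q ≤ (∑' j, c j) ^ (q - 1) * ∑' j, c j * a j ^ q := by
  have hq0 : 0 < q := by linarith
  rw [← ENNReal.le_rpow_inv_iff hq0]
  rw [ENNReal.tsum_eq_iSup_sum]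
  refine iSup_le fun s => ?_
  refine (ENNReal.inner_le_weight_mul_Lp_of_nonneg s hq c a).trans ?_
  rw [ENNReal.mul_rpow_of_nonneg _ _ (by positivity), ← ENNReal.rpow_mul]
  have : (q - 1) * q⁻¹ = 1 - q⁻¹ := by field_simp
  rw [this]
  have h1 : 0 ≤ 1 - q⁻¹ := by
    have := inv_le_one_of_one_le₀ hq
    linarith
  gcongr
  · exact ENNReal.sum_le_tsum s
  · exact ENNReal.sum_le_tsum s

/-- The Schur test. -/
theorem lpE_schur (hp : 1 ≤ p) (c : ι → κ → ℝ≥0∞) (D : ℝ≥0∞) (hrow : ∀ i, ∑' j, c i j ≤ D)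
    (hcol : ∀ j, ∑' i, c i j ≤ D) (a : κ → ℝ≥0∞) :
    lpE p (fun i => ∑' j, c i j * a j) ≤ D * lpE p a := by
  by_cases hp' : p = ∞
  · subst hp'
    simp only [lpE_top]
    refine iSup_le fun i => ?_
    calc ∑' j, c i j * a j ≤ ∑' j, c i j * ⨆ k, a k := by
          gcongr with j
          exact le_iSup a j
      _ = (∑' j, c i j) * ⨆ k, a k := ENNReal.tsum_mul_right
      _ ≤ _ := by gcongr; exact hrow i
  · have h1 := one_le_toReal hp hp'
    rw [lpE_le_iff hp hp', ENNReal.mul_rpow_of_nonneg _ _ ENNReal.toReal_nonneg, lpE_rpow hp hp']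
    calc ∑' i, (∑' j, c i j * a j) ^ p.toReal
        -- Jensen with row i as weights uses the row bound and costs D^(p-1); after the sums are
        -- interchanged, the column bound supplies the last factor D.
        ≤ ∑' i, D ^ (p.toReal - 1) * ∑' j, c i j * a j ^ p.toReal := by
          gcongr with i
          refine (tsum_mul_rpow_le h1 (c i) a).trans ?_
          gcongr
          exact hrow i
      _ = D ^ (p.toReal - 1) * ∑' j, (∑' i, c i j) * a j ^ p.toReal := by
          rw [ENNReal.tsum_mul_left, ENNReal.tsum_comm]
          simp only [ENNReal.tsum_mul_right]
      _ ≤ D ^ (p.toReal - 1) * ∑' j, D * a j ^ p.toReal := by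
          gcongr with j
          exact hcol j
      _ = D ^ p.toReal * ∑' j, a j ^ p.toReal := by
          rw [ENNReal.tsum_mul_left, ← mul_assoc]
          congr 1
          nth_rewrite 2 [← ENNReal.rpow_one D]
          rw [← ENNReal.rpow_add_of_nonneg _ _ (by linarith) zero_le_one, sub_add_cancel]

/-- A crude substitute for Minkowski's inequality: (a+b)^p ≤ 2^(p-1)(a^p + b^p) termwise, then A^p +
B^p ≤ (A+B)^p. -/
theorem lpE_add_le (hp : 1 ≤ p) (a b : ι → ℝ≥0∞) :
    lpE p (fun k => a k + b k) ≤ 2 * (lpE p a + lpE p b) := by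
  by_cases hp' : p = ∞
  · subst hp'
    simp only [lpE_top]
    refine iSup_le fun k => ?_
    calc a k + b k ≤ 1 * ((⨆ k, a k) + ⨆ k, b k) := by
          rw [one_mul]; exact add_le_add (le_iSup a k) (le_iSup b k)
      _ ≤ _ := by gcongr; norm_num
  · have h1 := one_le_toReal hp hp'
    have h0 : 0 ≤ p.toReal := by linarith
    rw [lpE_le_iff hp hp', ENNReal.mul_rpow_of_nonneg _ _ h0]
    calc ∑' k, (a k + b k) ^ p.toReal
        ≤ ∑' k, 2 ^ (p.toReal - 1) * (a k ^ p.toReal + b k ^ p.toReal) := by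
          gcongr with k
          exact ENNReal.rpow_add_le_mul_rpow_add_rpow _ _ h1
      _ = 2 ^ (p.toReal - 1) * (lpE p a ^ p.toReal + lpE p b ^ p.toReal) := by
          rw [ENNReal.tsum_mul_left, ENNReal.tsum_add, lpE_rpow hp hp', lpE_rpow hp hp']
      _ ≤ 2 ^ p.toReal * (lpE p a + lpE p b) ^ p.toReal := by
          gcongr
          · norm_num
          · linarith
          · exact ENNReal.add_rpow_le_rpow_add _ _ h1

end lpE

/-- The sum of three neighbouring terms. -/
noncomputable def neighbourSum (a : ℤ → ℝ≥0∞) (k : ℤ) : ℝ≥0∞ := a (k - 1) + a k + a (k + 1)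

/-- Estimates through the Z₁/Z₂ alternative use the term at k or at an adjacent index. The symmetric
sum absorbs this shift at the cost of a factor 3. -/
theorem lpE_neighbourSum_le {p : ℝ≥0∞} (hp : 1 ≤ p) (a : ℤ → ℝ≥0∞) :
    lpE p (neighbourSum a) ≤ 3 * lpE p a := by
  -- A tridiagonal 0-1 matrix; all row and column sums are 3, so the Schur test applies.
  let c : ℤ → ℤ → ℝ≥0∞ := fun i j =>
    (if j = i - 1 then 1 else 0) + (if j = i then 1 else 0) + (if j = i + 1 then 1 else 0)
  have hc : ∀ i, neighbourSum a i = ∑' j, c i j * a j := fun i => by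
    simp only [c, add_mul, ENNReal.tsum_add, ite_mul, one_mul, zero_mul, tsum_ite_eq]
    rfl
  simp only [funext hc]
  refine lpE_schur hp c 3 (fun i => ?_) (fun j => ?_) a
  · simp only [c, ENNReal.tsum_add, tsum_ite_eq]
    norm_num
  · have e1 : ∀ i : ℤ, (j = i - 1) = (i = j + 1) := fun i => by grind
    have e2 : ∀ i : ℤ, (j = i) = (i = j) := fun i => by grind
    have e3 : ∀ i : ℤ, (i + 1 = j) = (i = j - 1) := fun i => by grind
    simp only [c, ENNReal.tsum_add, e1, e2, e3, tsum_ite_eq]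
    norm_num

theorem neighbourSum_le {a : ℤ → ℝ≥0∞} {R : ℝ≥0∞} (h : ∀ k, a k ≤ R) (k : ℤ) :
    neighbourSum a k ≤ 3 * R :=
  (add_le_add (add_le_add (h _) (h _)) (h _)).trans_eq (by ring)

/-! ### Geometric sums and quasi-concave functions -/

/-- The largest term of a finite subsum dominates: the terms below it add up to at most twice half
of it. Arbitrary gaps in `G` are harmless. -/
theorem tsum_indicator_le_of_doubling {a : ℤ → ℝ≥0∞} (ha : ∀ k, 2 * a k ≤ a (k + 1)) {G : Set ℤ}
    {B : ℝ≥0∞} (hG : ∀ k ∈ G, a k ≤ B) : ∑' k, G.indicator a k ≤ 2 * B := by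
  classical
  have hlt : ∀ k n, k < n → 2 * a k ≤ a n := fun k n hkn => by
    have hmono : Monotone a := monotone_int_of_le_succ fun k =>
      (le_mul_of_one_le_left zero_le one_le_two).trans (ha k)
    exact (ha k).trans (hmono hkn)
  have hfin : ∀ F : Finset ℤ, ∀ B : ℝ≥0∞, (∀ k ∈ F, a k ≤ B) → ∑ k ∈ F, a k ≤ 2 * B := by
    intro F
    induction F using Finset.induction_on_max with
    | empty => simp
    | insert m F hF ih =>
      intro B hB
      have hm : m ∉ F := fun h => lt_irrefl _ (hF m h)
      rw [Finset.sum_insert hm, two_mul]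
      have h1 : ∑ k ∈ F, a k ≤ 2 * (a m / 2) := ih _ fun k hk => by
        rw [ENNReal.le_div_iff_mul_le (by simp) (by simp), mul_comm]
        exact hlt k m (hF k hk)
      rw [ENNReal.mul_div_cancel (by simp) (by simp)] at h1
      have h2 := hB m (Finset.mem_insert_self _ _)
      exact add_le_add h2 (h1.trans h2)
  rw [ENNReal.tsum_eq_iSup_sum]
  refine iSup_le fun F => ?_
  rw [Finset.sum_indicator_eq_sum_filter]
  exact hfin _ B fun k hk => hG k (Finset.mem_filter.1 hk).2

theorem tsum_indicator_le_of_halving {a : ℤ → ℝ≥0∞} (ha : ∀ k, 2 * a (k + 1) ≤ a k) {G : Set ℤ}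
    {B : ℝ≥0∞} (hG : ∀ k ∈ G, a k ≤ B) : ∑' k, G.indicator a k ≤ 2 * B := by
  have := tsum_indicator_le_of_doubling (a := fun k => a (-k)) (G := (fun k => -k) ⁻¹' G) (B := B)
    (fun k => by simpa [add_comm] using ha (-(k + 1))) (fun k hk => hG _ hk)
  rw [← (Equiv.neg ℤ).tsum_eq]
  exact this

theorem StronglyIncreasing.two_mul_le {a : ℤ → ℝ} (h : StronglyIncreasing a) (k : ℤ) :
    2 * a k ≤ a (k + 1) :=
  (le_div_iff₀ (h.1 k)).1 (h.2 k)

theorem StronglyDecreasing.two_mul_le {a : ℤ → ℝ} (h : StronglyDecreasing a) (k : ℤ) :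
    2 * a (k + 1) ≤ a k := by
  have := (div_le_iff₀ (h.1 k)).1 (h.2 k)
  linarith

theorem StronglyIncreasing.tsum_indicator_le {a : ℤ → ℝ} (h : StronglyIncreasing a) {G : Set ℤ}
    {B : ℝ} (hG : ∀ k ∈ G, a k ≤ B) :
    ∑' k, G.indicator (fun k => ENNReal.ofReal (a k)) k ≤ ENNReal.ofReal (2 * B) := by
  rw [ENNReal.ofReal_mul zero_le_two, ENNReal.ofReal_ofNat]
  refine tsum_indicator_le_of_doubling (fun k => ?_) fun k hk => ENNReal.ofReal_le_ofReal (hG k hk)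
  rw [← ENNReal.ofReal_ofNat 2, ← ENNReal.ofReal_mul zero_le_two]
  exact ENNReal.ofReal_le_ofReal (h.two_mul_le k)

theorem StronglyDecreasing.tsum_indicator_le {a : ℤ → ℝ} (h : StronglyDecreasing a) {G : Set ℤ}
    {B : ℝ} (hG : ∀ k ∈ G, a k ≤ B) :
    ∑' k, G.indicator (fun k => ENNReal.ofReal (a k)) k ≤ ENNReal.ofReal (2 * B) := by
  rw [ENNReal.ofReal_mul zero_le_two, ENNReal.ofReal_ofNat]
  refine tsum_indicator_le_of_halving (fun k => ?_) fun k hk => ENNReal.ofReal_le_ofReal (hG k hk)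
  rw [← ENNReal.ofReal_ofNat 2, ← ENNReal.ofReal_mul zero_le_two]
  exact ENNReal.ofReal_le_ofReal (h.two_mul_le k)

theorem StronglyIncreasing.inv {a : ℤ → ℝ} (h : StronglyIncreasing a) :
    StronglyDecreasing fun k => (a k)⁻¹ :=
  ⟨fun k => inv_pos.2 (h.1 k), fun k => by
    rw [inv_div_inv, div_le_iff₀ (h.1 _)]
    linarith [h.two_mul_le k]⟩

theorem StronglyDecreasing.inv {a : ℤ → ℝ} (h : StronglyDecreasing a) :
    StronglyIncreasing fun k => (a k)⁻¹ :=
  ⟨fun k => inv_pos.2 (h.1 k), fun k => by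
    rw [inv_div_inv, le_div_iff₀ (h.1 _)]
    exact h.two_mul_le k⟩

theorem StronglyIncreasing.monotone {a : ℤ → ℝ} (h : StronglyIncreasing a) : Monotone a :=
  monotone_int_of_le_succ fun k => by linarith [h.two_mul_le k, h.1 k]

theorem StronglyIncreasing.pow_mul_le {a : ℤ → ℝ} (h : StronglyIncreasing a) (k : ℤ) (n : ℕ) :
    2 ^ n * a k ≤ a (k + n) := by
  induction n with
  | zero => simp
  | succ n ih =>
    have := h.two_mul_le (k + n)
    push_cast
    rw [← add_assoc, pow_succ]
    linarith

theorem StronglyIncreasing.exists_mem_Ico {a : ℤ → ℝ} (h : StronglyIncreasing a) {r : ℝ}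
    (hr : 0 < r) : ∃ m, a m ≤ r ∧ r < a (m + 1) := by
  obtain ⟨n, hn⟩ := pow_unbounded_of_one_lt (r / a 0) one_lt_two
  obtain ⟨l, hl⟩ := pow_unbounded_of_one_lt (a 0 / r) one_lt_two
  rw [div_lt_iff₀ (h.1 0)] at hn
  rw [div_lt_iff₀ hr] at hl
  have hn' := h.pow_mul_le 0 n
  have hl' := h.pow_mul_le (-l) l
  rw [neg_add_cancel] at hl'
  rw [zero_add] at hn'
  have hbdd : ∀ z, a z ≤ r → z ≤ n := fun z hz => by
    by_contra! hlt
    have := h.monotone hlt.le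
    linarith
  have hex : a (-l) ≤ r := by
    have : (0 : ℝ) < 2 ^ l := by positivity
    exact le_of_mul_le_mul_left (hl'.trans hl.le) this
  obtain ⟨m, hm1, hm2⟩ := Int.exists_greatest_of_bdd (P := fun m => a m ≤ r) ⟨n, hbdd⟩ ⟨-l, hex⟩
  refine ⟨m, hm1, lt_of_not_ge fun hge => ?_⟩
  have := hm2 _ hge
  omega

theorem StronglyIncreasing.tendsto_atTop {a : ℤ → ℝ} (h : StronglyIncreasing a) :
    Tendsto (fun n : ℕ => a n) atTop atTop := by
  refine tendsto_atTop_mono (fun n => ?_)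
    ((tendsto_pow_atTop_atTop_of_one_lt one_lt_two).atTop_mul_const (h.1 0))
  simpa using h.pow_mul_le 0 n

theorem StronglyIncreasing.tendsto_neg {a : ℤ → ℝ} (h : StronglyIncreasing a) :
    Tendsto (fun n : ℕ => a (-n)) atTop (𝓝 0) := by
  have h1 : StronglyIncreasing fun k => (a (-k))⁻¹ := ⟨fun k => inv_pos.2 (h.1 _), fun k => by
    have := h.two_mul_le (-(k + 1))
    rw [inv_div_inv, le_div_iff₀ (h.1 _)]
    simpa using this⟩
  refine h1.tendsto_atTop.inv_tendsto_atTop.congr fun n => ?_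
  simp

/-- Positive quasi-concave functions on `(0, ∞)`. -/
structure IsQuasiConcave (f : ℝ → ℝ) : Prop where
  pos : ∀ t, 0 < t → 0 < f t
  mono : MonotoneOn f (Ioi 0)
  anti : AntitoneOn (fun t => f t / t) (Ioi 0)

theorem IsNondegQuasiConcave.isQuasiConcave {f : ℝ → ℝ} (h : IsNondegQuasiConcave f) :
    IsQuasiConcave f := ⟨h.pos, h.mono, h.anti⟩

/-- The function dual to a quasi-concave one. -/
theorem IsQuasiConcave.dual {f : ℝ → ℝ} (h : IsQuasiConcave f) :
    IsQuasiConcave fun t => t / f t := by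
  refine ⟨fun t ht => div_pos ht (h.pos t ht), fun s hs t ht hst => ?_, fun s hs t ht hst => ?_⟩
  · have := h.anti hs ht hst
    simp only at this ⊢
    rw [← inv_div, ← inv_div (f t)]
    exact inv_anti₀ (div_pos (h.pos t ht) ht) this
  · have := h.mono hs ht hst
    have hs' : s ≠ 0 := ne_of_gt hs
    have ht' : t ≠ 0 := ne_of_gt ht
    have e1 : t / f t / t = (f t)⁻¹ := by field_simp
    have e2 : s / f s / s = (f s)⁻¹ := by field_simp
    simp only [e1, e2]
    exact inv_anti₀ (h.pos s hs) this

/-- Split at v_k ≤ s. Below, the terms are w_k, geometrically increasing and at most M f(v_k) ≤ M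
f(s). Above, they are at most s w_k/v_k, geometrically decreasing and at most s M f(v_k)/v_k ≤ M
f(s). Each half contributes 2 M f(s). -/
theorem IsQuasiConcave.tsum_atoms_le {f : ℝ → ℝ} (hf : IsQuasiConcave f) {v w : ℤ → ℝ}
    (hv : ∀ k, 0 < v k) (hw : StronglyIncreasing w) (hd : StronglyDecreasing fun k => w k / v k)
    {G : Set ℤ} {M : ℝ} (hM : 0 ≤ M) (hG : ∀ k ∈ G, w k ≤ M * f (v k)) {s : ℝ} (hs : 0 < s) :
    ∑' k, G.indicator (fun k => ENNReal.ofReal (w k * min 1 (s / v k))) k ≤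
      ENNReal.ofReal (4 * (M * f s)) := by
  have hlow : ∑' k, (G ∩ {k | v k ≤ s}).indicator (fun k => ENNReal.ofReal (w k)) k ≤
      ENNReal.ofReal (2 * (M * f s)) :=
    hw.tsum_indicator_le fun k hk => (hG k hk.1).trans
      (mul_le_mul_of_nonneg_left (hf.mono (hv k) hs hk.2) hM)
  have hhigh : ∑' k, (G ∩ {k | s < v k}).indicator (fun k => ENNReal.ofReal (w k / v k)) k ≤
      ENNReal.ofReal (2 * (M * (f s / s))) :=
    hd.tsum_indicator_le fun k hk => by
      calc w k / v k ≤ M * f (v k) / v k := by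
            gcongr
            · exact (hv k).le
            · exact hG k hk.1
        _ = M * (f (v k) / v k) := by ring
        _ ≤ _ := mul_le_mul_of_nonneg_left (hf.anti hs (hv k) (le_of_lt hk.2)) hM
  have hfs := hf.pos s hs
  calc ∑' k, G.indicator (fun k => ENNReal.ofReal (w k * min 1 (s / v k))) k
      ≤ ∑' k, ((G ∩ {k | v k ≤ s}).indicator (fun k => ENNReal.ofReal (w k)) k +
          ENNReal.ofReal s *
            (G ∩ {k | s < v k}).indicator (fun k => ENNReal.ofReal (w k / v k)) k) := by
        gcongr with k
        by_cases hk : k ∈ G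
        · rcases le_or_gt (v k) s with hks | hks
          · refine le_trans ?_ le_self_add
            rw [indicator_of_mem hk, indicator_of_mem (show k ∈ G ∩ {k | v k ≤ s} from ⟨hk, hks⟩)]
            refine ENNReal.ofReal_le_ofReal (mul_le_of_le_one_right (hw.1 k).le (min_le_left _ _))
          · refine le_trans ?_ le_add_self
            rw [indicator_of_mem hk, indicator_of_mem (show k ∈ G ∩ {k | s < v k} from ⟨hk, hks⟩),
              ← ENNReal.ofReal_mul hs.le]
            refine ENNReal.ofReal_le_ofReal ?_
            calc w k * min 1 (s / v k) ≤ w k * (s / v k) :=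
                  mul_le_mul_of_nonneg_left (min_le_right _ _) (hw.1 k).le
              _ = _ := by ring
        · rw [indicator_of_notMem hk]
          exact zero_le
    _ ≤ ENNReal.ofReal (2 * (M * f s)) +
          ENNReal.ofReal s * ENNReal.ofReal (2 * (M * (f s / s))) := by
        rw [ENNReal.tsum_add, ENNReal.tsum_mul_left]
        gcongr
    _ = _ := by
        rw [← ENNReal.ofReal_mul hs.le, ← ENNReal.ofReal_add (by positivity) (by positivity)]
        congr 1
        field_simp
        ring

/-- This is `tsum_atoms_le` for the dual function t/f(t) with weights v_k/w_k, divided by s. Passing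
to the dual turns the bound for f(v_k) by w_k into the bound needed there. -/
theorem IsQuasiConcave.tsum_dual_atoms_le {f : ℝ → ℝ} (hf : IsQuasiConcave f) {v w : ℤ → ℝ}
    (hv : ∀ k, 0 < v k) (hw : StronglyIncreasing w) (hd : StronglyDecreasing fun k => w k / v k)
    {G : Set ℤ} {M : ℝ} (hM : 0 ≤ M) (hG : ∀ k ∈ G, f (v k) ≤ M * w k) {s : ℝ} (hs : 0 < s) :
    ∑' k, G.indicator (fun k => ENNReal.ofReal (min 1 (v k / s) / w k)) k ≤
      ENNReal.ofReal (4 * (M / f s)) := by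
  have hw' : StronglyIncreasing fun k => v k / w k := by
    simpa only [inv_div] using hd.inv
  have hd' : StronglyDecreasing fun k => v k / w k / v k := by
    have : (fun k => v k / w k / v k) = fun k => (w k)⁻¹ := funext fun k => by
      have := (hv k).ne'
      field_simp
    rw [this]
    exact hw.inv
  have key := hf.dual.tsum_atoms_le hv hw' hd' hM (G := G) (fun k hk => by
    have h1 := hG k hk
    have h2 := hw.1 k
    have h3 := hf.pos _ (hv k)
    have h4 := hv k
    rw [← mul_div_assoc, div_le_div_iff₀ h2 h3]
    calc v k * f (v k) ≤ v k * (M * w k) := by gcongr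
      _ = _ := by ring) hs
  have hfs := hf.pos s hs
  calc ∑' k, G.indicator (fun k => ENNReal.ofReal (min 1 (v k / s) / w k)) k
      = ∑' k, ENNReal.ofReal s⁻¹ *
          G.indicator (fun k => ENNReal.ofReal (v k / w k * min 1 (s / v k))) k := by
        congr 1
        ext k
        by_cases hk : k ∈ G
        · rw [indicator_of_mem hk, indicator_of_mem hk, ← ENNReal.ofReal_mul (by positivity)]
          congr 1
          have h2 := hw.1 k
          have h4 := hv k
          rcases le_total (v k) s with h | h
          · rw [min_eq_right ((div_le_one hs).2 h), min_eq_left ((one_le_div h4).2 h)]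
            field_simp
          · rw [min_eq_left ((one_le_div hs).2 h), min_eq_right ((div_le_one h4).2 h)]
            field_simp
        · simp [indicator_of_notMem hk]
    _ ≤ ENNReal.ofReal s⁻¹ * ENNReal.ofReal (4 * (M * (s / f s))) := by
        rw [ENNReal.tsum_mul_left]
        gcongr
    _ = _ := by
        rw [← ENNReal.ofReal_mul (by positivity)]
        congr 1
        field_simp

/-! ### The K-functional -/

section General

variable {A : Type*} [AddCommGroup A] {N₀ N₁ : A → ℝ≥0∞} {s t : ℝ} {x : A}

theorem K_add_le (N₀ N₁ : A → ℝ≥0∞) (t : ℝ) (x₀ x₁ : A) :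
    K N₀ N₁ t (x₀ + x₁) ≤ N₀ x₀ + ENNReal.ofReal t * N₁ x₁ :=
  iInf_le_of_le x₀ (iInf_le_of_le x₁ (iInf_le_of_le rfl le_rfl))

theorem le_K {B : ℝ≥0∞} (h : ∀ x₀ x₁, x₀ + x₁ = x → B ≤ N₀ x₀ + ENNReal.ofReal t * N₁ x₁) :
    B ≤ K N₀ N₁ t x :=
  le_iInf fun x₀ => le_iInf fun x₁ => le_iInf fun hx => h x₀ x₁ hx

theorem exists_of_K_lt {B : ℝ≥0∞} (h : K N₀ N₁ t x < B) :
    ∃ x₀ x₁, x₀ + x₁ = x ∧ N₀ x₀ + ENNReal.ofReal t * N₁ x₁ < B := by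
  simpa only [K, iInf_lt_iff, exists_prop] using h

theorem K_mono (hst : s ≤ t) : K N₀ N₁ s x ≤ K N₀ N₁ t x :=
  le_K fun x₀ x₁ hx => by
    subst hx
    refine (K_add_le N₀ N₁ s x₀ x₁).trans ?_
    gcongr

theorem K_le_div_mul (hs : 0 < s) (hst : s ≤ t) :
    K N₀ N₁ t x ≤ ENNReal.ofReal (t / s) * K N₀ N₁ s x := by
  have hpos : 0 < t / s := div_pos (hs.trans_le hst) hs
  rw [mul_comm, ← ENNReal.div_le_iff_le_mul (.inl (ENNReal.ofReal_pos.2 hpos).ne')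
    (.inl ENNReal.ofReal_ne_top)]
  · refine le_K fun x₀ x₁ hx => ?_
    subst hx
    rw [ENNReal.div_le_iff_le_mul (.inl (ENNReal.ofReal_pos.2 hpos).ne')
      (.inl ENNReal.ofReal_ne_top)]
    refine (K_add_le N₀ N₁ t x₀ x₁).trans ?_
    rw [add_mul]
    refine add_le_add ?_ (le_of_eq ?_)
    · refine le_mul_of_one_le_right zero_le ?_
      rw [ENNReal.one_le_ofReal, le_div_iff₀ hs]
      linarith
    · rw [mul_right_comm, ← ENNReal.ofReal_mul hs.le, mul_div_cancel₀ _ hs.ne']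

end General

/-! ### Countable subadditivity of the K-functional of a Banach couple -/

section Couple

variable {𝕜 : Type*} [RCLike 𝕜] {X₀ X₁ A : Type*}
  [NormedAddCommGroup X₀] [NormedSpace 𝕜 X₀] [CompleteSpace X₀]
  [NormedAddCommGroup X₁] [NormedSpace 𝕜 X₁] [CompleteSpace X₁]
  [AddCommGroup A] [Module 𝕜 A] [TopologicalSpace A] [IsTopologicalAddGroup A]
  [ContinuousSMul 𝕜 A] [T2Space A] (X : BanachCouple 𝕜 X₀ X₁ A)

/-- The K-functional of a Banach couple. -/
noncomputable def BanachCouple.kFun (t : ℝ) (x : A) : ℝ≥0∞ :=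
  K (imageNorm X.incl₀) (imageNorm X.incl₁) t x

theorem BanachCouple.interp_eq (φ : ℝ → ℝ) (t : ℤ → ℝ) (p : ℝ≥0∞) (x : A) :
    X.interp φ t p x = lpE p fun k => X.kFun (t k) x / ENNReal.ofReal (φ (t k)) := rfl

theorem exists_of_imageNorm_lt {E F : Type*} [NormedAddCommGroup E] {j : E → F} {x : F}
    {B : ℝ≥0∞} (h : imageNorm j x < B) : ∃ y, j y = x ∧ ‖y‖ₑ < B := by
  simpa only [imageNorm, iInf_lt_iff, exists_prop] using h

theorem imageNorm_apply_le {E F : Type*} [NormedAddCommGroup E] (j : E → F) (y : E) :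
    imageNorm j (j y) ≤ ‖y‖ₑ :=
  iInf_le_of_le y (iInf_le_of_le rfl le_rfl)

theorem BanachCouple.kFun_le (t : ℝ) (y : X₀) (z : X₁) :
    X.kFun t (X.incl₀ y + X.incl₁ z) ≤ ‖y‖ₑ + ENNReal.ofReal t * ‖z‖ₑ := by
  refine (K_add_le _ _ _ _ _).trans ?_
  gcongr
  · exact imageNorm_apply_le _ y
  · exact imageNorm_apply_le _ z

variable {X}

theorem BanachCouple.exists_of_kFun_lt {t : ℝ} (ht : 0 < t) {x : A} {B : ℝ≥0∞}
    (h : X.kFun t x < B) :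
    ∃ (y : X₀) (z : X₁), X.incl₀ y + X.incl₁ z = x ∧ ‖y‖ₑ + ENNReal.ofReal t * ‖z‖ₑ < B := by
  obtain ⟨x₀, x₁, hx, hlt⟩ := exists_of_K_lt h
  have ht0 : ENNReal.ofReal t ≠ 0 := (ENNReal.ofReal_pos.2 ht).ne'
  have h0 : imageNorm X.incl₀ x₀ ≠ ∞ := ne_top_of_le_ne_top hlt.ne_top le_self_add
  -- Positivity of t is needed: at t = 0 the convention 0 · ∞ = 0 would let x₁ lie outside X₁.
  have h1 : imageNorm X.incl₁ x₁ ≠ ∞ := fun h => by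
    rw [h, ENNReal.mul_top ht0, add_top] at hlt
    exact not_top_lt hlt
  obtain ⟨y, rfl, -⟩ := exists_of_imageNorm_lt h0.lt_top
  obtain ⟨z, rfl, -⟩ := exists_of_imageNorm_lt h1.lt_top
  refine ⟨y, z, hx, lt_of_le_of_lt ?_ hlt⟩
  gcongr
  · exact le_iInf fun y' => le_iInf fun hy => by rw [X.injective₀ hy]
  · exact le_iInf fun z' => le_iInf fun hz => by rw [X.injective₁ hz]

theorem BanachCouple.kFun_zero (t : ℝ) : X.kFun t 0 = 0 := by
  have := X.kFun_le t 0 0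
  simpa using this

/-- Decompositions of cost tending to 0 have both parts tending to 0 in X₀ and X₁, hence in A by
continuity; limits in the Hausdorff space A are unique. -/
theorem BanachCouple.eq_zero_of_kFun_eq_zero {t : ℝ} (ht : 0 < t) {x : A} (h : X.kFun t x = 0) :
    x = 0 := by
  have hex : ∀ n : ℕ, ∃ (y : X₀) (z : X₁), X.incl₀ y + X.incl₁ z = x ∧
      ‖y‖ₑ + ENNReal.ofReal t * ‖z‖ₑ < ENNReal.ofReal (1 / (n + 1)) := fun n =>
    exists_of_kFun_lt ht (by rw [h]; exact ENNReal.ofReal_pos.2 (by positivity))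
  choose y z hyz hlt using hex
  have hlim : Tendsto (fun n : ℕ => (1 : ℝ) / (n + 1)) atTop (𝓝 0) :=
    tendsto_one_div_add_atTop_nhds_zero_nat
  have hreal : ∀ n, ‖y n‖ + t * ‖z n‖ ≤ 1 / (n + 1) := fun n => by
    have h1 := (hlt n).le
    rw [← ofReal_norm, ← ofReal_norm, ← ENNReal.ofReal_mul ht.le,
      ← ENNReal.ofReal_add (by positivity) (by positivity)] at h1
    exact (ENNReal.ofReal_le_ofReal_iff (by positivity)).1 h1
  have hy : Tendsto y atTop (𝓝 0) := by
    refine squeeze_zero_norm (fun n => ?_) hlim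
    have := hreal n
    have : 0 ≤ t * ‖z n‖ := by positivity
    linarith
  have hz : Tendsto z atTop (𝓝 0) := by
    refine squeeze_zero_norm (a := fun n : ℕ => (1 : ℝ) / (n + 1) / t) (fun n => ?_)
      (by simpa using hlim.div_const t)
    rw [le_div_iff₀ ht]
    have := hreal n
    have := norm_nonneg (y n)
    linarith
  have hsum := ((X.incl₀.continuous.tendsto 0).comp hy).add ((X.incl₁.continuous.tendsto 0).comp hz)
  simp only [map_zero, add_zero] at hsum
  have hconst : Tendsto (fun _ : ℕ => x) atTop (𝓝 0) :=
    hsum.congr fun n => hyz n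
  exact tendsto_nhds_unique tendsto_const_nhds hconst

/-- Nearly optimal decompositions of the u_k, with errors summing to less than ε, have absolutely
summable parts. Completeness of X₀ and X₁ sums them separately, and continuity of the inclusions
carries the sums to A. -/
theorem BanachCouple.exists_decomposition {ι : Type*} [Countable ι] {u : ι → A} {t : ℝ}
    (ht : 0 < t) (hfin : ∑' k, X.kFun t (u k) ≠ ∞) {ε : ℝ≥0∞} (hε : ε ≠ 0) :
    ∃ (y : X₀) (z : X₁), HasSum u (X.incl₀ y + X.incl₁ z) ∧
      ‖y‖ₑ + ENNReal.ofReal t * ‖z‖ₑ ≤ (∑' k, X.kFun t (u k)) + ε := by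
  wlog hε' : ε ≠ ∞ generalizing ε
  · obtain ⟨y, z, h, -⟩ := this one_ne_zero ENNReal.one_ne_top
    exact ⟨y, z, h, by simp [not_not.1 hε']⟩
  obtain ⟨δ, hδ, hδsum⟩ := ENNReal.exists_pos_sum_of_countable' hε ι
  have hex : ∀ k, ∃ (y : X₀) (z : X₁), X.incl₀ y + X.incl₁ z = u k ∧
      ‖y‖ₑ + ENNReal.ofReal t * ‖z‖ₑ < X.kFun t (u k) + δ k := fun k =>
    exists_of_kFun_lt ht (ENNReal.lt_add_right (ENNReal.ne_top_of_tsum_ne_top hfin k) (hδ k).ne')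
  choose y z hyz hlt using hex
  have htot : (∑' k, ‖y k‖ₑ) + ENNReal.ofReal t * ∑' k, ‖z k‖ₑ ≤
      (∑' k, X.kFun t (u k)) + ε := by
    rw [← ENNReal.tsum_mul_left, ← ENNReal.tsum_add]
    refine (ENNReal.tsum_le_tsum fun k => (hlt k).le).trans ?_
    rw [ENNReal.tsum_add]
    gcongr
  have hne : (∑' k, X.kFun t (u k)) + ε ≠ ∞ := ENNReal.add_ne_top.2 ⟨hfin, hε'⟩
  have hysum : ∑' k, ‖y k‖ₑ ≠ ∞ := ne_top_of_le_ne_top hne (le_self_add.trans htot)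
  have hzsum : ∑' k, ‖z k‖ₑ ≠ ∞ := fun h => by
    rw [h, ENNReal.mul_top (ENNReal.ofReal_pos.2 ht).ne', add_top] at htot
    exact hne (top_le_iff.1 htot)
  have hys : Summable y := Summable.of_enorm hysum
  have hzs : Summable z := Summable.of_enorm hzsum
  refine ⟨∑' k, y k, ∑' k, z k, ?_, le_trans ?_ htot⟩
  · have := (hys.hasSum.mapL X.incl₀).add (hzs.hasSum.mapL X.incl₁)
    simpa only [hyz] using this
  · gcongr
    · exact enorm_tsum_le_tsum_enorm
    · exact enorm_tsum_le_tsum_enorm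

theorem BanachCouple.summable_of_kFun {ι : Type*} [Countable ι] {u : ι → A} {t : ℝ}
    (ht : 0 < t) (hfin : ∑' k, X.kFun t (u k) ≠ ∞) : Summable u := by
  obtain ⟨y, z, h, -⟩ := exists_decomposition ht hfin one_ne_zero
  exact h.summable

/-- The K-functional is countably subadditive. -/
theorem BanachCouple.kFun_hasSum_le {ι : Type*} [Countable ι] {u : ι → A} {x : A}
    (hu : HasSum u x) {t : ℝ} (ht : 0 < t) : X.kFun t x ≤ ∑' k, X.kFun t (u k) := by
  by_cases hfin : ∑' k, X.kFun t (u k) = ∞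
  · rw [hfin]
    exact le_top
  refine ENNReal.le_of_forall_pos_le_add fun ε hε _ => ?_
  obtain ⟨y, z, h, hle⟩ := exists_decomposition ht hfin (ENNReal.coe_pos.2 hε).ne'
  rw [hu.unique h]
  exact (X.kFun_le t y z).trans hle

theorem BanachCouple.kFun_add_le {t : ℝ} (ht : 0 < t) (x y : A) :
    X.kFun t (x + y) ≤ X.kFun t x + X.kFun t y := by
  have h : HasSum (fun b : Bool => cond b x y) (x + y) := by
    simpa using hasSum_fintype (fun b : Bool => cond b x y)
  have := X.kFun_hasSum_le h ht
  simpa using this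

end Couple

/-! ### Discretized estimates -/

section Estimates

variable {A : Type*} [AddCommGroup A] {N₀ N₁ : A → ℝ≥0∞} {p : ℝ≥0∞} {f : ℝ → ℝ} {τ v w : ℤ → ℝ}

theorem interpNorm_eq (φ : ℝ → ℝ) (t : ℤ → ℝ) (p : ℝ≥0∞) (N₀ N₁ : A → ℝ≥0∞) (x : A) :
    interpNorm φ t p N₀ N₁ x = lpE p fun k => K N₀ N₁ (t k) x / ENNReal.ofReal (φ (t k)) := rfl

/-- A single term of the sum suffices. With τ_i ≤ u < τ_{i+1}, it is the i-th when i ∈ Z₁ (compare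
K(u) with K(τ_{i+1})) and the (i+1)-st when i ∈ Z₂ (compare K(u)/u with K(τ_i)/τ_i). The sum has the
form of a matrix acting on a sequence, as the Schur test requires. -/
theorem K_le_tsum_atoms (hτ : IsDiscretizing f τ) (x : A) {u : ℝ} (hu : 0 < u) :
    K N₀ N₁ u x ≤ 2 * ∑' i, ENNReal.ofReal (f (τ i) * min 1 (u / τ i)) *
      neighbourSum (fun i => K N₀ N₁ (τ i) x / ENNReal.ofReal (f (τ i))) i := by
  set β : ℤ → ℝ≥0∞ := fun i => K N₀ N₁ (τ i) x / ENNReal.ofReal (f (τ i)) with hβ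
  have hτ0 := hτ.strongIncr.1
  have hf0 := hτ.strongIncr_comp.1
  have hK : ∀ i, K N₀ N₁ (τ i) x = ENNReal.ofReal (f (τ i)) * β i := fun i =>
    (ENNReal.mul_div_cancel (ENNReal.ofReal_pos.2 (hf0 i)).ne' ENNReal.ofReal_ne_top).symm
  obtain ⟨i, hi1, hi2⟩ := hτ.strongIncr.exists_mem_Ico hu
  obtain ⟨Z₁, Z₂, hU, -, h1, h2⟩ := hτ.decomposition
  have hterm : ∀ i, ENNReal.ofReal (f (τ i) * min 1 (u / τ i)) * neighbourSum β i ≤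
      ∑' i, ENNReal.ofReal (f (τ i) * min 1 (u / τ i)) * neighbourSum β i :=
    fun i => ENNReal.le_tsum i
  have htwo : (2 : ℝ≥0∞) = ENNReal.ofReal 2 := (ENNReal.ofReal_ofNat 2).symm
  rcases (hU ▸ mem_univ i : i ∈ Z₁ ∪ Z₂) with hi | hi
  · calc K N₀ N₁ u x ≤ K N₀ N₁ (τ (i + 1)) x := K_mono hi2.le
      _ = ENNReal.ofReal (f (τ (i + 1))) * β (i + 1) := hK _
      _ ≤ ENNReal.ofReal (2 * f (τ i)) * neighbourSum β i := by
          gcongr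
          · exact h1 i hi
          · exact le_add_self
      _ = 2 * (ENNReal.ofReal (f (τ i) * min 1 (u / τ i)) * neighbourSum β i) := by
          rw [min_eq_left ((one_le_div (hτ0 i)).2 hi1), mul_one, ENNReal.ofReal_mul zero_le_two,
            ← htwo, mul_assoc]
      _ ≤ _ := by
          gcongr
          exact hterm i
  · calc K N₀ N₁ u x ≤ ENNReal.ofReal (u / τ i) * K N₀ N₁ (τ i) x := K_le_div_mul (hτ0 i) hi1
      _ = ENNReal.ofReal (u * (f (τ i) / τ i)) * β i := by
          rw [hK, ← mul_assoc, ← ENNReal.ofReal_mul (div_pos hu (hτ0 i)).le]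
          congr 2
          ring
      _ ≤ ENNReal.ofReal (u * (2 * (f (τ (i + 1)) / τ (i + 1)))) * neighbourSum β (i + 1) := by
          gcongr
          · exact h2 i hi
          · rw [neighbourSum, add_sub_cancel_right, add_assoc]
            exact le_self_add
      _ = 2 * (ENNReal.ofReal (f (τ (i + 1)) * min 1 (u / τ (i + 1))) *
            neighbourSum β (i + 1)) := by
          rw [min_eq_right ((div_le_one (hτ0 _)).2 hi2.le), ← mul_assoc 2, htwo,
            ← ENNReal.ofReal_mul zero_le_two]
          congr 2
          ring
      _ ≤ _ := by
          gcongr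
          exact hterm (i + 1)

/-- Resampling: the norm of X_{f,p} controls K along any other sequence v, with weights w, on the
indices where w dominates f(v). The constant is 24 = 4 · 2 · 3, from the Schur test,
`K_le_tsum_atoms` and the neighbour sum. -/
theorem lpE_indicator_K_le (hp : 1 ≤ p) (hf : IsQuasiConcave f) (hτ : IsDiscretizing f τ)
    (hv : ∀ k, 0 < v k) (hw : StronglyIncreasing w) (hd : StronglyDecreasing fun k => w k / v k)
    {G : Set ℤ} {M : ℝ} (hM : 0 ≤ M) (hG : ∀ k ∈ G, f (v k) ≤ M * w k) (x : A) :
    lpE p (G.indicator fun k => K N₀ N₁ (v k) x / ENNReal.ofReal (w k)) ≤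
      ENNReal.ofReal M * (24 * interpNorm f τ p N₀ N₁ x) := by
  set β : ℤ → ℝ≥0∞ := fun i => K N₀ N₁ (τ i) x / ENNReal.ofReal (f (τ i)) with hβ
  have hτ0 := hτ.strongIncr.1
  have hf0 := hτ.strongIncr_comp.1
  let c : ℤ → ℤ → ℝ≥0∞ := fun k i =>
    G.indicator (fun k => ENNReal.ofReal (f (τ i) * (min 1 (v k / τ i) / w k))) k
  have hle : ∀ k, G.indicator (fun k => K N₀ N₁ (v k) x / ENNReal.ofReal (w k)) k ≤
      ∑' i, c k i * (2 * neighbourSum β i) := fun k => by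
    by_cases hk : k ∈ G
    · simp only [c, indicator_of_mem hk]
      rw [ENNReal.div_le_iff_le_mul (.inl (ENNReal.ofReal_pos.2 (hw.1 k)).ne')
        (.inl ENNReal.ofReal_ne_top), ← ENNReal.tsum_mul_right]
      refine (K_le_tsum_atoms hτ x (hv k)).trans_eq ?_
      rw [← ENNReal.tsum_mul_left]
      congr 1
      ext i
      have e : f (τ i) * min 1 (v k / τ i) = f (τ i) * (min 1 (v k / τ i) / w k) * w k := by
        have := (hw.1 k).ne'
        field_simp
      rw [e, ENNReal.ofReal_mul' (hw.1 k).le]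
      ring
    · rw [indicator_of_notMem hk]
      exact zero_le
  refine (lpE_mono hp hle).trans ?_
  refine (lpE_schur hp c (ENNReal.ofReal (4 * M)) (fun k => ?_) (fun i => ?_) _).trans ?_
  · by_cases hk : k ∈ G
    · have h1 := hf.tsum_atoms_le (w := fun i => f (τ i)) (G := univ) hτ0 hτ.strongIncr_comp
        hτ.strongDecr_div zero_le_one (fun i _ => (one_mul _).ge) (hv k)
      simp only [indicator_univ, one_mul] at h1
      have hwk := hw.1 k
      calc ∑' i, c k i
          = ∑' i, ENNReal.ofReal (f (τ i) * min 1 (v k / τ i)) * ENNReal.ofReal (w k)⁻¹ := by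
            congr 1
            ext i
            simp only [c, indicator_of_mem hk]
            rw [← ENNReal.ofReal_mul' (by positivity)]
            congr 1
            ring
        _ ≤ ENNReal.ofReal (4 * f (v k)) * ENNReal.ofReal (w k)⁻¹ := by
            rw [ENNReal.tsum_mul_right]
            gcongr
        _ ≤ _ := by
            rw [← ENNReal.ofReal_mul' (by positivity)]
            refine ENNReal.ofReal_le_ofReal ?_
            rw [← div_eq_mul_inv, div_le_iff₀ hwk]
            linarith [hG k hk]
    · simp only [c, indicator_of_notMem hk, tsum_zero]
      exact zero_le
  · have h1 := hf.tsum_dual_atoms_le hv hw hd hM hG (hτ0 i)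
    have hfi := hf0 i
    calc ∑' k, c k i = ∑' k, ENNReal.ofReal (f (τ i)) *
          G.indicator (fun k => ENNReal.ofReal (min 1 (v k / τ i) / w k)) k := by
          congr 1
          ext k
          by_cases hk : k ∈ G
          · simp only [c, indicator_of_mem hk]
            rw [← ENNReal.ofReal_mul hfi.le]
          · simp [c, indicator_of_notMem hk]
      _ ≤ ENNReal.ofReal (f (τ i)) * ENNReal.ofReal (4 * (M / f (τ i))) := by
          rw [ENNReal.tsum_mul_left]
          gcongr
      _ = _ := by
          rw [← ENNReal.ofReal_mul hfi.le]
          congr 1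
          field_simp
  · rw [lpE_const_mul hp, interpNorm_eq]
    calc ENNReal.ofReal (4 * M) * (2 * lpE p (neighbourSum β))
        ≤ ENNReal.ofReal (4 * M) * (2 * (3 * lpE p β)) := by
          gcongr
          exact lpE_neighbourSum_le hp β
      _ = _ := by
          rw [ENNReal.ofReal_mul (by norm_num), ENNReal.ofReal_ofNat]
          ring

/-- Controls all the truncated atomic sums y_m at once, by a Schur test from k to the pairs (m, i).
A row sum is at most 4 by `tsum_atoms_le`. In a column, the m with k ∈ G_m satisfy 1/μ_m ≤
f(v_k)/w_k, so the geometric sum over m gives 2 f(v_k)/w_k, while the sum over i gives 4 w_k/f(v_k);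
hence 8. -/
theorem lpE_interpNorm_div_le (hp : 1 ≤ p) (hf : IsQuasiConcave f) (hτ : IsDiscretizing f τ)
    (hv : ∀ k, 0 < v k) (hw : StronglyIncreasing w) (hd : StronglyDecreasing fun k => w k / v k)
    {μ : ℤ → ℝ} (hμ : StronglyIncreasing μ ∨ StronglyDecreasing μ) {G : ℤ → Set ℤ}
    (hG : ∀ m, ∀ k ∈ G m, w k ≤ μ m * f (v k)) (γ : ℤ → ℝ≥0∞) (y : ℤ → A)
    (hy : ∀ m s, 0 < s → K N₀ N₁ s (y m) ≤
      ∑' k, (G m).indicator (fun k => ENNReal.ofReal (w k * min 1 (s / v k))) k * γ k) :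
    lpE p (fun m => interpNorm f τ p N₀ N₁ (y m) / ENNReal.ofReal (μ m)) ≤ 8 * lpE p γ := by
  have hτ0 := hτ.strongIncr.1
  have hf0 := hτ.strongIncr_comp.1
  have hμ0 : ∀ m, 0 < μ m := by
    rcases hμ with h | h
    · exact h.1
    · exact h.1
  let c : ℤ × ℤ → ℤ → ℝ≥0∞ := fun q k =>
    (ENNReal.ofReal (μ q.1))⁻¹ * ((ENNReal.ofReal (f (τ q.2)))⁻¹ *
      (G q.1).indicator (fun k => ENNReal.ofReal (w k * min 1 (τ q.2 / v k))) k)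
  have hle : lpE p (fun m => interpNorm f τ p N₀ N₁ (y m) / ENNReal.ofReal (μ m)) ≤
      lpE p fun q => ∑' k, c q k * γ k := by
    rw [lpE_prod hp (fun m i => ∑' k, c (m, i) k * γ k)]
    refine lpE_mono hp fun m => ?_
    rw [interpNorm_eq, div_eq_mul_inv, mul_comm, ← lpE_const_mul hp]
    refine lpE_mono hp fun i => ?_
    rw [div_eq_mul_inv, mul_comm (K _ _ _ _)]
    simp only [c, mul_assoc, ENNReal.tsum_mul_left]
    gcongr
    exact hy m _ (hτ0 i)
  refine hle.trans (lpE_schur hp c 8 (fun q => ?_) (fun k => ?_) γ)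
  · obtain ⟨m, i⟩ := q
    have h1 := hf.tsum_atoms_le hv hw hd (hμ0 m).le (hG m) (hτ0 i)
    have hm := hμ0 m
    have hi := hf0 i
    simp only [c, ENNReal.tsum_mul_left]
    calc _ ≤ (ENNReal.ofReal (μ m))⁻¹ * ((ENNReal.ofReal (f (τ i)))⁻¹ *
          ENNReal.ofReal (4 * (μ m * f (τ i)))) := by gcongr
      _ = ENNReal.ofReal 4 := by
          rw [← ENNReal.ofReal_inv_of_pos hm, ← ENNReal.ofReal_inv_of_pos hi,
            ← ENNReal.ofReal_mul (by positivity), ← ENNReal.ofReal_mul (by positivity)]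
          congr 1
          field_simp
      _ ≤ 8 := by
          rw [ENNReal.ofReal_ofNat]
          norm_num
  · have hk := hw.1 k
    have hfk := hf.pos _ (hv k)
    have hcol := hf.tsum_dual_atoms_le (w := fun i => f (τ i)) (G := univ) hτ0 hτ.strongIncr_comp
        hτ.strongDecr_div zero_le_one (fun i _ => (one_mul _).ge) (hv k)
    simp only [indicator_univ] at hcol
    have hmbd : ∀ m ∈ {m | k ∈ G m}, (μ m)⁻¹ ≤ f (v k) / w k := fun m hm => by
      have hm0 := hμ0 m
      rw [inv_le_comm₀ hm0 (by positivity), inv_div, div_le_iff₀ hfk]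
      exact hG m k hm
    have hmsum : ∑' m, {m | k ∈ G m}.indicator (fun m => ENNReal.ofReal (μ m)⁻¹) m ≤
        ENNReal.ofReal (2 * (f (v k) / w k)) := by
      rcases hμ with h | h
      · exact h.inv.tsum_indicator_le hmbd
      · exact h.inv.tsum_indicator_le hmbd
    rw [ENNReal.tsum_prod (f := fun m i => c (m, i) k)]
    calc ∑' m, ∑' i, c (m, i) k
        = ∑' m, {m | k ∈ G m}.indicator (fun m => ENNReal.ofReal (μ m)⁻¹) m *
            (ENNReal.ofReal (w k) * ∑' i, ENNReal.ofReal (min 1 (τ i / v k) / f (τ i))) := by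
          congr 1
          ext m
          by_cases hkm : k ∈ G m
          · rw [indicator_of_mem (show m ∈ {m | k ∈ G m} from hkm)]
            simp only [c, indicator_of_mem hkm]
            rw [ENNReal.tsum_mul_left, ENNReal.ofReal_inv_of_pos (hμ0 m)]
            congr 1
            rw [← ENNReal.tsum_mul_left]
            congr 1
            ext i
            have hi := hf0 i
            rw [← ENNReal.ofReal_inv_of_pos hi, ← ENNReal.ofReal_mul (by positivity),
              ← ENNReal.ofReal_mul hk.le]
            congr 1
            ring
          · rw [indicator_of_notMem (show m ∉ {m | k ∈ G m} from hkm)]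
            simp [c, indicator_of_notMem hkm]
      _ ≤ ENNReal.ofReal (2 * (f (v k) / w k)) *
            (ENNReal.ofReal (w k) * ENNReal.ofReal (4 * (1 / f (v k)))) := by
          rw [ENNReal.tsum_mul_right]
          gcongr
      _ = ENNReal.ofReal 8 := by
          rw [← ENNReal.ofReal_mul hk.le, ← ENNReal.ofReal_mul (by positivity)]
          congr 1
          field_simp
          norm_num
      _ ≤ 8 := by rw [ENNReal.ofReal_ofNat]

end Estimates

/-! ### The two embeddings -/

section Couple

variable {𝕜 : Type*} [RCLike 𝕜] {X₀ X₁ A : Type*}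
  [NormedAddCommGroup X₀] [NormedSpace 𝕜 X₀] [CompleteSpace X₀]
  [NormedAddCommGroup X₁] [NormedSpace 𝕜 X₁] [CompleteSpace X₁]
  [AddCommGroup A] [Module 𝕜 A] [TopologicalSpace A] [IsTopologicalAddGroup A]
  [ContinuousSMul 𝕜 A] [T2Space A] (X : BanachCouple 𝕜 X₀ X₁ A)
  {φ φ₀ φ₁ : ℝ → ℝ} {p : ℝ≥0∞} {τ z t t' : ℤ → ℝ}

/-- Resample the two parts of x = x₀ + x₁ separately by `lpE_indicator_K_le`. The hypotheses are
scaled so that the two bounds add up to (96/B)(‖x₀‖ + s‖x₁‖), with 96 = 2 · 2 · 24; then take the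
infimum over decompositions. -/
theorem BanachCouple.lpE_indicator_kFun_le (hp : 1 ≤ p)
    (hφ₀ : IsQuasiConcave φ₀) (hφ₁ : IsQuasiConcave φ₁)
    (hτ : IsDiscretizing φ₀ τ) (hz : IsDiscretizing φ₁ z) {v w : ℤ → ℝ} (hv : ∀ k, 0 < v k)
    (hw : StronglyIncreasing w) (hd : StronglyDecreasing fun k => w k / v k) {G : Set ℤ}
    {s B : ℝ} (hs : 0 < s) (hB : 0 < B) (h₀ : ∀ k ∈ G, φ₀ (v k) ≤ 2 / B * w k)
    (h₁ : ∀ k ∈ G, φ₁ (v k) ≤ 2 * s / B * w k) (x : A) :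
    lpE p (G.indicator fun k => X.kFun (v k) x / ENNReal.ofReal (w k)) ≤
      96 * (K (X.interp φ₀ τ p) (X.interp φ₁ z p) s x / ENNReal.ofReal B) := by
  have hB0 : ENNReal.ofReal B ≠ 0 := (ENNReal.ofReal_pos.2 hB).ne'
  have e2 : ENNReal.ofReal (2 / B) = 2 / ENNReal.ofReal B := by
    rw [ENNReal.ofReal_div_of_pos hB, ENNReal.ofReal_ofNat]
  have e3 : ENNReal.ofReal (2 * s / B) = 2 * ENNReal.ofReal s / ENNReal.ofReal B := by
    rw [ENNReal.ofReal_div_of_pos hB, ENNReal.ofReal_mul zero_le_two, ENNReal.ofReal_ofNat]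
  have key : ∀ x₀ x₁, x₀ + x₁ = x →
      lpE p (G.indicator fun k => X.kFun (v k) x / ENNReal.ofReal (w k)) ≤
      96 / ENNReal.ofReal B * (X.interp φ₀ τ p x₀ + ENNReal.ofReal s * X.interp φ₁ z p x₁) := by
    rintro x₀ x₁ rfl
    have hle : ∀ k, G.indicator (fun k => X.kFun (v k) (x₀ + x₁) / ENNReal.ofReal (w k)) k ≤
        G.indicator (fun k => X.kFun (v k) x₀ / ENNReal.ofReal (w k)) k +
          G.indicator (fun k => X.kFun (v k) x₁ / ENNReal.ofReal (w k)) k := fun k => by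
      by_cases hk : k ∈ G
      · simp only [indicator_of_mem hk]
        rw [← ENNReal.add_div]
        gcongr
        exact X.kFun_add_le (hv k) x₀ x₁
      · simp [indicator_of_notMem hk]
    refine (lpE_mono hp hle).trans ((lpE_add_le hp _ _).trans ?_)
    have b₀ : lpE p (G.indicator fun k => X.kFun (v k) x₀ / ENNReal.ofReal (w k)) ≤
        ENNReal.ofReal (2 / B) * (24 * X.interp φ₀ τ p x₀) :=
      lpE_indicator_K_le hp hφ₀ hτ hv hw hd (by positivity) h₀ x₀
    have b₁ : lpE p (G.indicator fun k => X.kFun (v k) x₁ / ENNReal.ofReal (w k)) ≤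
        ENNReal.ofReal (2 * s / B) * (24 * X.interp φ₁ z p x₁) :=
      lpE_indicator_K_le hp hφ₁ hz hv hw hd (by positivity) h₁ x₁
    refine (mul_le_mul_right (add_le_add b₀ b₁) 2).trans_eq ?_
    rw [e2, e3]
    simp only [div_eq_mul_inv]
    ring
  have : lpE p (G.indicator fun k => X.kFun (v k) x / ENNReal.ofReal (w k)) /
      (96 / ENNReal.ofReal B) ≤ K (X.interp φ₀ τ p) (X.interp φ₁ z p) s x := by
    refine le_K fun x₀ x₁ hx => ENNReal.div_le_of_le_mul' (key x₀ x₁ hx)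
  rw [ENNReal.div_le_iff_le_mul
    (.inl (ENNReal.div_pos (by norm_num) ENNReal.ofReal_ne_top).ne')
    (.inl (ENNReal.div_lt_top (by norm_num) hB0).ne)] at this
  refine this.trans_eq ?_
  simp only [div_eq_mul_inv]
  ring

theorem BanachCouple.interp_compose_le (hp : 1 ≤ p) (hφ : IsNondegQuasiConcave φ)
    (hφ₀ : IsNondegQuasiConcave φ₀) (hφ₁ : IsNondegQuasiConcave φ₁)
    (hτ : IsDiscretizing φ₀ τ) (hz : IsDiscretizing φ₁ z) (ht : IsDiscretizing φ t)
    (ht' : IsDiscretizing (compose φ φ₀ φ₁) t') (x : A) :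
    X.interp (compose φ φ₀ φ₁) t' p x ≤
      288 * interpNorm φ t p (X.interp φ₀ τ p) (X.interp φ₁ z p) x := by
  set w : ℤ → ℝ := fun k => compose φ φ₀ φ₁ (t' k) with hwdef
  set α : ℤ → ℝ≥0∞ := fun k => X.kFun (t' k) x / ENNReal.ofReal (w k) with hα
  set R : ℤ → ℝ≥0∞ := fun m =>
    K (X.interp φ₀ τ p) (X.interp φ₁ z p) (t m) x / ENNReal.ofReal (φ (t m)) with hR
  have hv := ht'.strongIncr.1
  have h₀pos : ∀ k, 0 < φ₀ (t' k) := fun k => hφ₀.pos _ (hv k)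
  have h₁pos : ∀ k, 0 < φ₁ (t' k) := fun k => hφ₁.pos _ (hv k)
  set r : ℤ → ℝ := fun k => φ₁ (t' k) / φ₀ (t' k) with hr
  have hr0 : ∀ k, 0 < r k := fun k => div_pos (h₁pos k) (h₀pos k)
  have hw : ∀ k, w k = φ₀ (t' k) * φ (r k) := fun k => rfl
  have hrφ₁ : ∀ k, φ₁ (t' k) = r k * φ₀ (t' k) := fun k => by
    have := (h₀pos k).ne'
    simp only [hr]
    field_simp
  have ht0 := ht.strongIncr.1
  choose n hn1 hn2 using fun k => ht.strongIncr.exists_mem_Ico (hr0 k)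
  let G : ℤ → Set ℤ := fun m => {k | n k = m}
  have hblock : ∀ m, lpE p ((G m).indicator α) ≤ 96 * neighbourSum R m := fun m => by
    obtain ⟨Z₁, Z₂, hU, -, hZ₁, hZ₂⟩ := ht.decomposition
    have hlow : ∀ k ∈ G m, t m ≤ r k := fun k hk => by
      have := hn1 k
      rwa [show n k = m from hk] at this
    have hup : ∀ k ∈ G m, r k ≤ t (m + 1) := fun k hk => by
      have := (hn2 k).le
      rwa [show n k = m from hk] at this
    have hφm := hφ.pos _ (ht0 m)
    have hφm' := hφ.pos _ (ht0 (m + 1))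
    have hm0 := ht0 m
    have hm0' := ht0 (m + 1)
    have hmono : ∀ k ∈ G m, φ (t m) ≤ φ (r k) := fun k hk =>
      hφ.mono (ht0 m) (hr0 k) (hlow k hk)
    have hanti : ∀ k ∈ G m, φ (t (m + 1)) / t (m + 1) ≤ φ (r k) / r k := fun k hk =>
      hφ.anti (hr0 k) (ht0 (m + 1)) (hup k hk)
    rcases (hU ▸ mem_univ m : m ∈ Z₁ ∪ Z₂) with hm | hm
    -- Here φ(t_{m+1}) ≤ 2φ(t_m) ≤ 2φ(r_k) on the block, so s = t_{m+1} and B = φ(s) work.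
    · have hZ := hZ₁ m hm
      refine (X.lpE_indicator_kFun_le hp hφ₀.isQuasiConcave hφ₁.isQuasiConcave hτ hz hv
        ht'.strongIncr_comp ht'.strongDecr_div (ht0 (m + 1)) hφm' (fun k hk => ?_)
        (fun k hk => ?_) x).trans ?_
      · change φ₀ (t' k) ≤ 2 / φ (t (m + 1)) * w k
        have h1 := hmono k hk
        have h2 := h₀pos k
        rw [hw, div_mul_eq_mul_div, le_div_iff₀ hφm']
        nlinarith
      · change φ₁ (t' k) ≤ 2 * t (m + 1) / φ (t (m + 1)) * w k
        have h1 := hanti k hk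
        have h2 := h₀pos k
        have h3 := hr0 k
        have h4 := hφ.pos _ h3
        rw [div_le_div_iff₀ hm0' h3] at h1
        rw [hw, hrφ₁, div_mul_eq_mul_div (2 * t (m + 1)), le_div_iff₀ hφm']
        have h5 : 0 ≤ φ₀ (t' k) * (φ (r k) * t (m + 1)) := by positivity
        nlinarith
      · gcongr
        exact le_add_self
    -- Here φ(t_m)/t_m ≤ 2φ(r_k)/r_k on the block, so s = t_m and B = φ(s) work.
    · have hZ := hZ₂ m hm
      refine (X.lpE_indicator_kFun_le hp hφ₀.isQuasiConcave hφ₁.isQuasiConcave hτ hz hv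
        ht'.strongIncr_comp ht'.strongDecr_div (ht0 m) hφm (fun k hk => ?_)
        (fun k hk => ?_) x).trans ?_
      · change φ₀ (t' k) ≤ 2 / φ (t m) * w k
        have h1 := hmono k hk
        have h2 := h₀pos k
        rw [hw, div_mul_eq_mul_div, le_div_iff₀ hφm]
        nlinarith
      · change φ₁ (t' k) ≤ 2 * t m / φ (t m) * w k
        have h1 := hanti k hk
        have h2 := h₀pos k
        have h3 := hr0 k
        have h4 : φ (t m) / t m ≤ 2 * (φ (r k) / r k) := hZ.trans (by linarith)
        rw [← mul_div_assoc, div_le_div_iff₀ hm0 h3] at h4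
        rw [hw, hrφ₁, div_mul_eq_mul_div (2 * t m), le_div_iff₀ hφm]
        nlinarith
      · gcongr
        rw [neighbourSum, add_assoc]
        exact le_self_add.trans le_add_self
  calc X.interp (compose φ φ₀ φ₁) t' p x = lpE p α := X.interp_eq _ _ _ _
    _ = lpE p fun k => (G (n k)).indicator α k := by
        congr 1
        ext k
        rw [indicator_of_mem (show k ∈ G (n k) from rfl)]
    -- The injection k ↦ (n_k, k) regroups the sequence by blocks.
    _ ≤ lpE p fun q : ℤ × ℤ => (G q.1).indicator α q.2 :=
        lpE_comp_le hp (fun q : ℤ × ℤ => (G q.1).indicator α q.2) (e := fun k => (n k, k))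
          fun a b hab => (Prod.ext_iff.1 hab).2
    _ = lpE p fun m => lpE p ((G m).indicator α) := lpE_prod hp fun m k => (G m).indicator α k
    _ ≤ lpE p fun m => 96 * neighbourSum R m := lpE_mono hp hblock
    _ ≤ 96 * (3 * lpE p R) := by
        rw [lpE_const_mul hp]
        gcongr
        exact lpE_neighbourSum_le hp R
    _ = _ := by
        rw [interpNorm_eq, ← mul_assoc]
        norm_num
        rfl

end Couple

/-! ### Atomic decomposition and the embedding into the iterated space -/

section Couple

variable {𝕜 : Type*} [RCLike 𝕜] {X₀ X₁ A : Type*}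
  [NormedAddCommGroup X₀] [NormedSpace 𝕜 X₀] [CompleteSpace X₀]
  [NormedAddCommGroup X₁] [NormedSpace 𝕜 X₁] [CompleteSpace X₁]
  [AddCommGroup A] [Module 𝕜 A] [TopologicalSpace A] [IsTopologicalAddGroup A]
  [ContinuousSMul 𝕜 A] [T2Space A] (X : BanachCouple 𝕜 X₀ X₁ A)

theorem norm_le_of_enorm_le {E : Type*} [NormedAddCommGroup E] {y : E} {R : ℝ≥0∞} {c : ℝ}
    (hR : R ≠ ∞) (hc : 0 ≤ c) (h : ‖y‖ₑ ≤ R * ENNReal.ofReal c) : ‖y‖ ≤ R.toReal * c := by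
  have := ENNReal.toReal_mono (ENNReal.mul_ne_top hR ENNReal.ofReal_ne_top) h
  rwa [toReal_enorm, ENNReal.toReal_mul, ENNReal.toReal_ofReal hc] at this

/-- Differences of nearly optimal decompositions at the points of a sequence. -/
theorem BanachCouple.exists_differences {v w : ℤ → ℝ} (hv : StronglyIncreasing v)
    (hw : StronglyIncreasing w) (hd : StronglyDecreasing fun k => w k / v k) {x : A} (hx : x ≠ 0)
    {R : ℝ≥0∞} (hR : R ≠ ∞) (hK : ∀ k, X.kFun (v k) x ≤ R * ENNReal.ofReal (w k)) :
    ∃ u : ℤ → A, (∀ y, HasSum u y → y = x) ∧ ∀ k s,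
      X.kFun s (u k) ≤ 4 * X.kFun (v (k + 1)) x ∧
      X.kFun s (u k) ≤ 4 * (ENNReal.ofReal (s / v k) * X.kFun (v k) x) := by
  have hv0 := hv.1
  have hKtop : ∀ k, X.kFun (v k) x ≠ ∞ := fun k =>
    ne_top_of_le_ne_top (ENNReal.mul_ne_top hR ENNReal.ofReal_ne_top) (hK k)
  have hK0 : ∀ k, X.kFun (v k) x ≠ 0 := fun k h => hx (X.eq_zero_of_kFun_eq_zero (hv0 k) h)
  -- A strict bound by 2K needs 0 < K < ∞; this is where x ≠ 0 enters.
  have hex : ∀ k, ∃ (a : X₀) (b : X₁), X.incl₀ a + X.incl₁ b = x ∧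
      ‖a‖ₑ + ENNReal.ofReal (v k) * ‖b‖ₑ < 2 * X.kFun (v k) x := fun k => by
    refine X.exists_of_kFun_lt (hv0 k) ?_
    rw [two_mul]
    exact ENNReal.lt_add_right (hKtop k) (hK0 k)
  choose a b hab hlt using hex
  have hmono : ∀ k, X.kFun (v k) x ≤ X.kFun (v (k + 1)) x := fun k =>
    K_mono (hv.monotone (by omega))
  have ha : ∀ k, ‖a k‖ₑ ≤ 2 * X.kFun (v k) x := fun k => le_self_add.trans (hlt k).le
  have hb : ∀ k, ‖b k‖ₑ ≤ 2 * (ENNReal.ofReal (v k)⁻¹ * X.kFun (v k) x) := fun k => by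
    have h0 := hv0 k
    calc ‖b k‖ₑ = ENNReal.ofReal (v k)⁻¹ * (ENNReal.ofReal (v k) * ‖b k‖ₑ) := by
          rw [← mul_assoc, ← ENNReal.ofReal_mul (by positivity), inv_mul_cancel₀ h0.ne',
            ENNReal.ofReal_one, one_mul]
      _ ≤ ENNReal.ofReal (v k)⁻¹ * (2 * X.kFun (v k) x) := by
          exact mul_le_mul_right (le_add_self.trans (hlt k).le) _
      _ = _ := by ring
  have hanti : ∀ k, ENNReal.ofReal (v (k + 1))⁻¹ * X.kFun (v (k + 1)) x ≤
      ENNReal.ofReal (v k)⁻¹ * X.kFun (v k) x := fun k => by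
    have h0 := hv0 k
    have h1 := hv0 (k + 1)
    calc ENNReal.ofReal (v (k + 1))⁻¹ * X.kFun (v (k + 1)) x
        ≤ ENNReal.ofReal (v (k + 1))⁻¹ * (ENNReal.ofReal (v (k + 1) / v k) * X.kFun (v k) x) := by
          gcongr
          exact K_le_div_mul h0 (hv.monotone (by omega))
      _ = _ := by
          rw [← mul_assoc, ← ENNReal.ofReal_mul (by positivity)]
          congr 2
          field_simp
  -- The difference lies in both spaces: its X₀ form gives the bound independent of s, its X₁ form
  -- the bound linear in s.
  have hu : ∀ k, X.incl₀ (a (k + 1) - a k) = X.incl₁ (b k - b (k + 1)) := fun k => by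
    have h1 := (hab k).trans (hab (k + 1)).symm
    rw [map_sub, map_sub, sub_eq_sub_iff_add_eq_add, ← h1]
    exact add_comm _ _
  refine ⟨fun k => X.incl₀ (a (k + 1) - a k), fun y hy => ?_, fun k s => ⟨?_, ?_⟩⟩
  -- The terms n and -(n+1) are paired, so the partial sums telescope to a_n - a_{-n} = x - b_n -
  -- a_{-n}. Since w_{-n} → 0 and w_n/v_n → 0, both remainders vanish.
  · have hpart : ∀ n : ℕ, ∑ i ∈ Finset.range n, (X.incl₀ (a ((i : ℤ) + 1) - a i) +
        X.incl₀ (a (-((i : ℤ) + 1) + 1) - a (-((i : ℤ) + 1)))) =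
        x - X.incl₁ (b n) - X.incl₀ (a (-n)) := fun n => by
      have h1 : x - X.incl₁ (b n) = X.incl₀ (a n) := by
        rw [← hab n]
        abel
      rw [h1]
      induction n with
      | zero => simp
      | succ n ih =>
        rw [Finset.sum_range_succ, ih (by rw [← hab n]; abel)]
        have e : -((n : ℤ) + 1) + 1 = -n := by ring
        push_cast
        rw [e]
        simp only [map_sub]
        abel
    have hlim := (hy.nat_add_neg_add_one).tendsto_sum_nat
    simp only [hpart] at hlim
    have ha0 : Tendsto (fun n : ℕ => a (-n)) atTop (𝓝 0) := by
      refine squeeze_zero_norm (a := fun n : ℕ => (2 * R).toReal * w (-n)) (fun n => ?_)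
        (by simpa using hw.tendsto_neg.const_mul (2 * R).toReal)
      refine norm_le_of_enorm_le (ENNReal.mul_ne_top (by norm_num) hR) (hw.1 _).le ?_
      refine (ha _).trans ?_
      rw [mul_assoc]
      gcongr
      exact hK _
    have hb0 : Tendsto (fun n : ℕ => b n) atTop (𝓝 0) := by
      have hwv : Tendsto (fun n : ℕ => w n / v n) atTop (𝓝 0) := by
        have := hd.inv.tendsto_atTop.inv_tendsto_atTop
        refine this.congr fun n => ?_
        simp
      refine squeeze_zero_norm (a := fun n : ℕ => (2 * R).toReal * (w n / v n)) (fun n => ?_)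
        (by simpa using hwv.const_mul (2 * R).toReal)
      refine norm_le_of_enorm_le (ENNReal.mul_ne_top (by norm_num) hR) (hd.1 n).le ?_
      have h0 := hv0 n
      refine (hb _).trans ?_
      rw [mul_assoc, div_eq_inv_mul, ENNReal.ofReal_mul (by positivity), mul_left_comm R]
      gcongr
      exact hK _
    have hlim' : Tendsto (fun n : ℕ => x - X.incl₁ (b n) - X.incl₀ (a (-n))) atTop (𝓝 x) := by
      have := ((tendsto_const_nhds (x := x)).sub ((X.incl₁.continuous.tendsto 0).comp hb0)).sub
        ((X.incl₀.continuous.tendsto 0).comp ha0)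
      simpa only [map_zero, sub_zero, Function.comp_def] using this
    exact tendsto_nhds_unique hlim hlim'
  · have := X.kFun_le s (a (k + 1) - a k) 0
    rw [map_zero, add_zero, enorm_zero, mul_zero, add_zero] at this
    calc _ ≤ ‖a (k + 1) - a k‖ₑ := this
      _ ≤ ‖a (k + 1)‖ₑ + ‖a k‖ₑ := enorm_sub_le
      _ ≤ 2 * X.kFun (v (k + 1)) x + 2 * X.kFun (v (k + 1)) x := by
          refine add_le_add (ha _) ((ha k).trans ?_)
          gcongr
          exact hmono k
      _ = _ := by ring
  · have := X.kFun_le s 0 (b k - b (k + 1))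
    rw [map_zero, zero_add, enorm_zero, zero_add] at this
    beta_reduce
    rw [hu]
    have h0 := hv0 k
    calc _ ≤ ENNReal.ofReal s * ‖b k - b (k + 1)‖ₑ := this
      _ ≤ ENNReal.ofReal s * (‖b k‖ₑ + ‖b (k + 1)‖ₑ) := by
          gcongr
          exact enorm_sub_le
      _ ≤ ENNReal.ofReal s * (2 * (ENNReal.ofReal (v k)⁻¹ * X.kFun (v k) x) +
            2 * (ENNReal.ofReal (v k)⁻¹ * X.kFun (v k) x)) := by
          gcongr
          · exact hb k
          · exact (hb (k + 1)).trans (mul_le_mul_right (hanti k) 2)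
      _ = _ := by
          rw [div_eq_mul_inv, ENNReal.ofReal_mul' (by positivity)]
          ring

/-- Every point of `X_{ψ,∞}` is the sum of a series of atoms along a discretizing sequence. -/
theorem BanachCouple.exists_atoms {ψ : ℝ → ℝ} (hψ : IsQuasiConcave ψ) {v : ℤ → ℝ}
    (hv : IsDiscretizing ψ v) (x : A) {R : ℝ≥0∞} (hR : R ≠ ∞)
    (hα : ∀ k, X.kFun (v k) x / ENNReal.ofReal (ψ (v k)) ≤ R) :
    ∃ U : ℤ → A, HasSum U x ∧ ∀ k s, 0 < s → X.kFun s (U k) ≤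
      ENNReal.ofReal (ψ (v k) * min 1 (s / v k)) *
        (16 * neighbourSum (fun k => X.kFun (v k) x / ENNReal.ofReal (ψ (v k))) k) := by
  rcases eq_or_ne x 0 with rfl | hx
  · exact ⟨fun _ => 0, hasSum_zero, fun k s _ => by rw [X.kFun_zero]; exact zero_le⟩
  set α : ℤ → ℝ≥0∞ := fun k => X.kFun (v k) x / ENNReal.ofReal (ψ (v k)) with hαdef
  have hv0 := hv.strongIncr.1
  have hψ0 := hv.strongIncr_comp.1
  have hKα : ∀ k, X.kFun (v k) x = α k * ENNReal.ofReal (ψ (v k)) := fun k =>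
    (ENNReal.div_mul_cancel (ENNReal.ofReal_pos.2 (hψ0 k)).ne' ENNReal.ofReal_ne_top).symm
  obtain ⟨u, hux, hu⟩ := X.exists_differences hv.strongIncr hv.strongIncr_comp hv.strongDecr_div
    hx hR (fun k => by
      rw [hKα]
      gcongr
      exact hα k)
  obtain ⟨Z₁, Z₂, hU, hdisj, hZ₁, hZ₂⟩ := hv.decomposition
  have hmin : ∀ {B C : ℝ≥0∞} {c d : ℝ}, B ≤ ENNReal.ofReal c * C → B ≤ ENNReal.ofReal d * C →
      B ≤ ENNReal.ofReal (min c d) * C := fun {B C c d} h1 h2 => by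
    rcases min_choice c d with h | h <;> rwa [h]
  have htwo : ENNReal.ofReal 2 = 2 := ENNReal.ofReal_ofNat 2
  -- For k ∈ Z₁, ψ(v_{k+1}) ≤ 2ψ(v_k) makes u_k an atom at v_k. For k ∈ Z₂ it is one at v_{k+1},
  -- which `hu₂` states with the index shifted by one.
  have hu₁ : ∀ k ∈ Z₁, ∀ s, 0 < s → X.kFun s (u k) ≤
      ENNReal.ofReal (ψ (v k) * min 1 (s / v k)) * (8 * neighbourSum α k) := fun k hk s hs => by
    rw [mul_min_of_nonneg _ _ (hψ0 k).le]
    have h0 := hv0 k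
    refine hmin ?_ ?_
    · calc X.kFun s (u k) ≤ 4 * X.kFun (v (k + 1)) x := (hu k s).1
        _ = 4 * (α (k + 1) * ENNReal.ofReal (ψ (v (k + 1)))) := by rw [hKα]
        _ ≤ 4 * (neighbourSum α k * ENNReal.ofReal (2 * ψ (v k))) := by
            gcongr
            · exact le_add_self
            · exact hZ₁ k hk
        _ = _ := by
            rw [ENNReal.ofReal_mul zero_le_two, htwo, mul_one]
            ring
    · calc X.kFun s (u k) ≤ 4 * (ENNReal.ofReal (s / v k) * X.kFun (v k) x) := (hu k s).2
        _ = 4 * (ENNReal.ofReal (s / v k) * (α k * ENNReal.ofReal (ψ (v k)))) := by rw [← hKα]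
        _ ≤ 8 * (ENNReal.ofReal (s / v k) * (neighbourSum α k * ENNReal.ofReal (ψ (v k)))) := by
            gcongr
            · norm_num
            · rw [neighbourSum, add_assoc]
              exact le_self_add.trans le_add_self
        _ = _ := by
            rw [ENNReal.ofReal_mul (hψ0 k).le]
            ring
  have hu₂ : ∀ k, k - 1 ∈ Z₂ → ∀ s, 0 < s → X.kFun s (u (k - 1)) ≤
      ENNReal.ofReal (ψ (v k) * min 1 (s / v k)) * (8 * neighbourSum α k) := fun k hk s hs => by
    rw [mul_min_of_nonneg _ _ (hψ0 k).le]
    have h0 := hv0 (k - 1)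
    have h1 := hv0 k
    refine hmin ?_ ?_
    · calc X.kFun s (u (k - 1)) ≤ 4 * X.kFun (v (k - 1 + 1)) x := (hu _ s).1
        _ = 4 * (α k * ENNReal.ofReal (ψ (v k))) := by rw [sub_add_cancel, hKα]
        _ ≤ 8 * (neighbourSum α k * ENNReal.ofReal (ψ (v k))) := by
            gcongr
            · norm_num
            · rw [neighbourSum, add_assoc]
              exact le_self_add.trans le_add_self
        _ = _ := by
            rw [mul_one]
            ring
    · have hZ := hZ₂ _ hk
      rw [sub_add_cancel] at hZ
      calc X.kFun s (u (k - 1))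
          ≤ 4 * (ENNReal.ofReal (s / v (k - 1)) * X.kFun (v (k - 1)) x) := (hu _ s).2
        _ = 4 * (α (k - 1) * ENNReal.ofReal (s * (ψ (v (k - 1)) / v (k - 1)))) := by
            have e : s * (ψ (v (k - 1)) / v (k - 1)) = s / v (k - 1) * ψ (v (k - 1)) := by ring
            rw [hKα, e, ENNReal.ofReal_mul (by positivity)]
            ring
        _ ≤ 4 * (neighbourSum α k * ENNReal.ofReal (s * (2 * (ψ (v k) / v k)))) := by
            gcongr
            rw [neighbourSum, add_assoc]
            exact le_self_add
        _ = _ := by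
            have e : s * (2 * (ψ (v k) / v k)) = 2 * (ψ (v k) * (s / v k)) := by ring
            rw [e, ENNReal.ofReal_mul zero_le_two, htwo]
            ring
  let u₁ : ℤ → A := Z₁.indicator u
  let u₂ : ℤ → A := fun k => Z₂.indicator u (k - 1)
  have hu₁' : ∀ k s, 0 < s → X.kFun s (u₁ k) ≤
      ENNReal.ofReal (ψ (v k) * min 1 (s / v k)) * (8 * neighbourSum α k) := fun k s hs => by
    by_cases hk : k ∈ Z₁
    · simpa only [u₁, indicator_of_mem hk] using hu₁ k hk s hs
    · simp only [u₁, indicator_of_notMem hk, X.kFun_zero]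
      exact zero_le
  have hu₂' : ∀ k s, 0 < s → X.kFun s (u₂ k) ≤
      ENNReal.ofReal (ψ (v k) * min 1 (s / v k)) * (8 * neighbourSum α k) := fun k s hs => by
    by_cases hk : k - 1 ∈ Z₂
    · simpa only [u₂, indicator_of_mem hk] using hu₂ k hk s hs
    · simp only [u₂, indicator_of_notMem hk, X.kFun_zero]
      exact zero_le
  -- K(1, ·) already detects summability, so the atomic bound is only needed at s = 1.
  have hsum : ∀ y : ℤ → A, (∀ k s, 0 < s → X.kFun s (y k) ≤
      ENNReal.ofReal (ψ (v k) * min 1 (s / v k)) * (8 * neighbourSum α k)) → Summable y :=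
    fun y hy => by
      refine X.summable_of_kFun one_pos (ne_top_of_le_ne_top ?_
        (ENNReal.tsum_le_tsum fun k => (hy k 1 one_pos).trans
          (mul_le_mul_right (mul_le_mul_right (neighbourSum_le hα k) 8) _)))
      rw [ENNReal.tsum_mul_right]
      have h1 := hψ.tsum_atoms_le (w := fun i => ψ (v i)) (G := univ) hv0 hv.strongIncr_comp
        hv.strongDecr_div zero_le_one (fun i _ => (one_mul _).ge) one_pos
      simp only [indicator_univ] at h1
      refine ENNReal.mul_ne_top (ne_top_of_le_ne_top ENNReal.ofReal_ne_top h1) ?_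
      exact ENNReal.mul_ne_top (by norm_num) (ENNReal.mul_ne_top (by norm_num) hR)
  have hs₁ := (hsum u₁ hu₁').hasSum
  have hs₂ := (hsum u₂ hu₂').hasSum
  refine ⟨fun k => u₁ k + u₂ k, ?_, fun k s hs => ?_⟩
  -- Undoing the shift recombines the two pieces into the series of u, whose only possible sum is x.
  · have hs₂' : HasSum (Z₂.indicator u) (∑' k, u₂ k) := (Equiv.subRight (1 : ℤ)).hasSum_iff.1 hs₂
    have hadd := hs₁.add hs₂'
    have e : (fun k => u₁ k + Z₂.indicator u k) = u := by
      have h1 := indicator_union_of_disjoint (disjoint_iff.2 hdisj) u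
      rw [hU, indicator_univ] at h1
      exact h1.symm
    rw [e] at hadd
    rw [← hux _ hadd]
    exact hs₁.add hs₂
  · refine (X.kFun_add_le hs _ _).trans ((add_le_add (hu₁' k s hs) (hu₂' k s hs)).trans_eq ?_)
    ring

theorem BanachCouple.interpNorm_interp_le {φ φ₀ φ₁ : ℝ → ℝ} {p : ℝ≥0∞} {τ z t t' : ℤ → ℝ}
    (hp : 1 ≤ p) (hφ : IsNondegQuasiConcave φ)
    (hφ₀ : IsNondegQuasiConcave φ₀) (hφ₁ : IsNondegQuasiConcave φ₁)
    (hτ : IsDiscretizing φ₀ τ) (hz : IsDiscretizing φ₁ z) (ht : IsDiscretizing φ t)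
    (ht' : IsDiscretizing (compose φ φ₀ φ₁) t') (x : A) :
    interpNorm φ t p (X.interp φ₀ τ p) (X.interp φ₁ z p) x ≤
      1536 * X.interp (compose φ φ₀ φ₁) t' p x := by
  by_cases hfin : X.interp (compose φ φ₀ φ₁) t' p x = ∞
  · rw [hfin, ENNReal.mul_top (by norm_num)]
    exact le_top
  set w : ℤ → ℝ := fun k => compose φ φ₀ φ₁ (t' k) with hwdef
  set α : ℤ → ℝ≥0∞ := fun k => X.kFun (t' k) x / ENNReal.ofReal (w k) with hαdef
  have hlpα : lpE p α = X.interp (compose φ φ₀ φ₁) t' p x := rfl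
  have hα : ∀ k, α k ≤ X.interp (compose φ φ₀ φ₁) t' p x := fun k => le_lpE hp α k
  have hψ := (hφ.compose hφ₀ hφ₁).isQuasiConcave
  obtain ⟨U, hUx, hU⟩ := X.exists_atoms hψ ht' x hfin hα
  have hv := ht'.strongIncr.1
  have hw := ht'.strongIncr_comp
  have hd := ht'.strongDecr_div
  have h₀pos : ∀ k, 0 < φ₀ (t' k) := fun k => hφ₀.pos _ (hv k)
  have h₁pos : ∀ k, 0 < φ₁ (t' k) := fun k => hφ₁.pos _ (hv k)
  let r : ℤ → ℝ := fun k => φ₁ (t' k) / φ₀ (t' k)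
  have hr0 : ∀ k, 0 < r k := fun k => div_pos (h₁pos k) (h₀pos k)
  have ht0 := ht.strongIncr.1
  -- On G_m one has ψ(t'_k) ≤ φ(t_m) φ₀(t'_k), since φ is non-decreasing; off G_m, ψ(t'_k) ≤
  -- (φ(t_m)/t_m) φ₁(t'_k), since φ(t)/t is non-increasing. So μ_m is φ(t_m) for the first part of x
  -- and φ(t_m)/t_m for the second.
  let G : ℤ → Set ℤ := fun m => {k | r k < t m}
  let γ : ℤ → ℝ≥0∞ := fun k => 16 * neighbourSum α k
  have hUind : ∀ (S : Set ℤ) (k : ℤ) (s : ℝ), 0 < s → X.kFun s (S.indicator U k) ≤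
      S.indicator (fun k => ENNReal.ofReal (w k * min 1 (s / t' k))) k * γ k := fun S k s hs => by
    by_cases hk : k ∈ S
    · simp only [indicator_of_mem hk]
      exact hU k s hs
    · simp [indicator_of_notMem hk, X.kFun_zero]
  have hsummable : ∀ S : Set ℤ, Summable (S.indicator U) := fun S => by
    refine X.summable_of_kFun one_pos (ne_top_of_le_ne_top ?_
      (ENNReal.tsum_le_tsum fun k => (hUind S k 1 one_pos).trans
        (mul_le_mul_right (mul_le_mul_right (neighbourSum_le hα k) 16) _)))
    rw [ENNReal.tsum_mul_right]
    have h1 := hψ.tsum_atoms_le (w := w) (G := S) hv hw hd zero_le_one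
      (fun i _ => (one_mul _).ge) one_pos
    refine ENNReal.mul_ne_top (ne_top_of_le_ne_top ENNReal.ofReal_ne_top h1) ?_
    exact ENNReal.mul_ne_top (by norm_num) (ENNReal.mul_ne_top (by norm_num) hfin)
  have hK : ∀ (S : Set ℤ) (s : ℝ), 0 < s → X.kFun s (∑' k, S.indicator U k) ≤
      ∑' k, S.indicator (fun k => ENNReal.ofReal (w k * min 1 (s / t' k))) k * γ k :=
    fun S s hs => (X.kFun_hasSum_le (hsummable S).hasSum hs).trans
      (ENNReal.tsum_le_tsum fun k => hUind S k s hs)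
  have hadd : ∀ m, (∑' k, (G m).indicator U k) + ∑' k, (G m)ᶜ.indicator U k = x := fun m => by
    have h1 := (hsummable (G m)).hasSum.add (hsummable (G m)ᶜ).hasSum
    have e : (fun k => (G m).indicator U k + (G m)ᶜ.indicator U k) = U := by
      ext k
      exact congrFun (indicator_self_add_compl (G m) U) k
    rw [e] at h1
    exact h1.unique hUx
  have hγ : lpE p γ ≤ 48 * X.interp (compose φ φ₀ φ₁) t' p x := by
    rw [lpE_const_mul hp, ← hlpα]
    calc 16 * lpE p (neighbourSum α) ≤ 16 * (3 * lpE p α) := by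
          gcongr
          exact lpE_neighbourSum_le hp α
      _ = _ := by ring
  have b₀ : lpE p (fun m => X.interp φ₀ τ p (∑' k, (G m).indicator U k) /
      ENNReal.ofReal (φ (t m))) ≤ 8 * lpE p γ := by
    refine lpE_interpNorm_div_le hp hφ₀.isQuasiConcave hτ hv hw hd (.inl ht.strongIncr_comp)
      (fun m k hk => ?_) γ _ (fun m s hs => hK (G m) s hs)
    change φ₀ (t' k) * φ (r k) ≤ φ (t m) * φ₀ (t' k)
    rw [mul_comm]
    exact mul_le_mul_of_nonneg_right (hφ.mono (hr0 k) (ht0 m) (le_of_lt hk)) (h₀pos k).le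
  have b₁ : lpE p (fun m => X.interp φ₁ z p (∑' k, (G m)ᶜ.indicator U k) /
      ENNReal.ofReal (φ (t m) / t m)) ≤ 8 * lpE p γ := by
    refine lpE_interpNorm_div_le hp hφ₁.isQuasiConcave hz hv hw hd (.inr ht.strongDecr_div)
      (fun m k hk => ?_) γ _ (fun m s hs => hK (G m)ᶜ s hs)
    have h0 := h₀pos k
    have h1 := h₁pos k
    calc φ₀ (t' k) * φ (r k) = φ (r k) / r k * φ₁ (t' k) := by
          simp only [r]
          field_simp
      _ ≤ _ := mul_le_mul_of_nonneg_right
          (hφ.anti (ht0 m) (hr0 k) (not_lt.1 hk)) (h₁pos k).le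
  calc interpNorm φ t p (X.interp φ₀ τ p) (X.interp φ₁ z p) x
      = lpE p fun m => K (X.interp φ₀ τ p) (X.interp φ₁ z p) (t m) x /
          ENNReal.ofReal (φ (t m)) := rfl
    _ ≤ lpE p fun m => X.interp φ₀ τ p (∑' k, (G m).indicator U k) / ENNReal.ofReal (φ (t m)) +
          X.interp φ₁ z p (∑' k, (G m)ᶜ.indicator U k) / ENNReal.ofReal (φ (t m) / t m) := by
        refine lpE_mono hp fun m => ?_
        have h1 := K_add_le (X.interp φ₀ τ p) (X.interp φ₁ z p) (t m)
          (∑' k, (G m).indicator U k) (∑' k, (G m)ᶜ.indicator U k)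
        rw [hadd m] at h1
        refine (ENNReal.div_le_div_right h1 _).trans_eq ?_
        have hφm := hφ.pos _ (ht0 m)
        have htm := ht0 m
        rw [ENNReal.add_div]
        congr 1
        rw [div_eq_mul_inv, div_eq_mul_inv, ← ENNReal.ofReal_inv_of_pos hφm,
          ← ENNReal.ofReal_inv_of_pos (by positivity), inv_div, div_eq_mul_inv,
          ENNReal.ofReal_mul htm.le]
        ring
    -- Here 48 = 16 · 3 (atoms and neighbour sum), 8 comes from `lpE_interpNorm_div_le`, and the
    -- outer 2 from `lpE_add_le`: 1536 in total.
    _ ≤ 2 * (8 * (48 * X.interp (compose φ φ₀ φ₁) t' p x) +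
          8 * (48 * X.interp (compose φ φ₀ φ₁) t' p x)) := by
        refine (lpE_add_le hp _ _).trans ?_
        gcongr
        · exact b₀.trans (mul_le_mul_right hγ 8)
        · exact b₁.trans (mul_le_mul_right hγ 8)
    _ = _ := by ring

end Couple

end RealInterpolation

theorem theorem3p7 {𝕜 : Type*} [RCLike 𝕜]
    (φ φ₀ φ₁ : ℝ → ℝ)
    (hφ : RealInterpolation.IsNondegQuasiConcave φ)
    (hφ₀ : RealInterpolation.IsNondegQuasiConcave φ₀)
    (hφ₁ : RealInterpolation.IsNondegQuasiConcave φ₁)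
    (p : ENNReal) (hp : 1 ≤ p)
    (τ z t t' : ℤ → ℝ)
    (hτ : RealInterpolation.IsDiscretizing φ₀ τ)
    (hz : RealInterpolation.IsDiscretizing φ₁ z)
    (ht : RealInterpolation.IsDiscretizing φ t)
    (ht' : RealInterpolation.IsDiscretizing (RealInterpolation.compose φ φ₀ φ₁) t') :
    ∃ C : NNReal, ∀ (X₀ X₁ A : Type*)
      [NormedAddCommGroup X₀] [NormedSpace 𝕜 X₀] [CompleteSpace X₀]
      [NormedAddCommGroup X₁] [NormedSpace 𝕜 X₁] [CompleteSpace X₁]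
      [AddCommGroup A] [Module 𝕜 A] [TopologicalSpace A] [IsTopologicalAddGroup A]
      [ContinuousSMul 𝕜 A] [T2Space A] (X : RealInterpolation.BanachCouple 𝕜 X₀ X₁ A),
      RealInterpolation.space
          (RealInterpolation.interpNorm φ t p (X.interp φ₀ τ p) (X.interp φ₁ z p)) =
        RealInterpolation.space (X.interp (RealInterpolation.compose φ φ₀ φ₁) t' p) ∧
      ∀ x : A,
        RealInterpolation.interpNorm φ t p (X.interp φ₀ τ p) (X.interp φ₁ z p) x ≤
          C * X.interp (RealInterpolation.compose φ φ₀ φ₁) t' p x ∧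
        X.interp (RealInterpolation.compose φ φ₀ φ₁) t' p x ≤
          C * RealInterpolation.interpNorm φ t p (X.interp φ₀ τ p) (X.interp φ₁ z p) x := by
  -- The larger of the two constants 1536 and 288; it depends on neither the functions, the
  -- sequences nor p.
  refine ⟨1536, fun X₀ X₁ A => ?_⟩
  intro _ _ _ _ _ _ _ _ _ _ _ _ X
  have h1 : ∀ x, RealInterpolation.interpNorm φ t p (X.interp φ₀ τ p) (X.interp φ₁ z p) x ≤
      ((1536 : NNReal) : ENNReal) * X.interp (RealInterpolation.compose φ φ₀ φ₁) t' p x :=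
    fun x => X.interpNorm_interp_le hp hφ hφ₀ hφ₁ hτ hz ht ht' x
  have h2 : ∀ x, X.interp (RealInterpolation.compose φ φ₀ φ₁) t' p x ≤ ((1536 : NNReal) : ENNReal) *
      RealInterpolation.interpNorm φ t p (X.interp φ₀ τ p) (X.interp φ₁ z p) x := fun x => by
    refine (X.interp_compose_le hp hφ hφ₀ hφ₁ hτ hz ht ht' x).trans ?_
    gcongr
    rw [ENNReal.coe_ofNat]
    norm_num
  refine ⟨Set.ext fun x => ⟨fun hx => ?_, fun hx => ?_⟩, fun x => ⟨h1 x, h2 x⟩⟩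
  · exact (h2 x).trans_lt (ENNReal.mul_lt_top ENNReal.coe_lt_top hx)
  · exact (h1 x).trans_lt (ENNReal.mul_lt_top ENNReal.coe_lt_top hx)
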